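/- Let $a,b\ge 2$ be integers and let $\nu\vdash b$ be a partition. All modules are over $\mathbb{C}$; $S^\nu$ denotes the Specht module of $S_b$, spanned by the polytabloids $e_t$ ($t$ a $\nu$-tableau), and for $m\ge1$ the generalized Foulkes module is $F_\nu^m=\bigl(\mathrm{Inf}_{S_b}^{S_m\wr S_b}S^\nu\bigr)\uparrow^{S_{mb}}$. For an ordered partition $X=(X_1,\dots,X_b)$ of $\{1,\dots,ab\}$ into $b$ sets of size $a$, written $X_i=gX^0_i$ with $g\in S_{ab}$ and $X^0$ the fixed ordered partition defining $S_a\wr S_b\le S_{ab}$, let $e_{t_X}=g\otimes e_t\in F_\nu^a$. Let $U_{\nu,a}$ be the $(1^b)$-component of the restriction of $F_\nu^a$ to $S_b\times S_{ab-b}$ (where $S_b$ acts on $\{1,\dots,b\}$ and $S_{ab-b}$ on $\{b+1,\dots,ab\}$), that is, the $S_b\times S_{ab-b}$-submodule generated by all $e_{t_X}$ with $t$ a $\nu$-tableau and $|X_i\cap\{1,\dots,b\}|=1$ for every $i$. For $\mu,\lambda\vdash b$ let $c_{\mu,\lambda}^\nu$ denote the Kronecker coefficient, that is, the multiplicity of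 $S^\nu$ in the $S_b$-module $S^\mu\otimes S^\lambda$. Then, as $S_b\times S_{ab-b}$-modules, \[ U_{\nu,a}\;\cong\;\bigoplus_{\mu,\lambda\vdash b}c_{\mu,\lambda}^{\nu}\; S^{\mu}\otimes F_{\lambda}^{a-1}, \] where $S^\mu\otimes F_\lambda^{a-1}$ is the outer tensor product of the $S_b$-module $S^\mu$ and the $S_{ab-b}$-module $F_\lambda^{a-1}$. In particular, for $a=2$, as $S_b\times S_b$-modules, \[ U_{\nu,2}\;\cong\;\bigoplus_{\mu,\lambda\vdash b}c_{\mu,\lambda}^{\nu}\; S^{\mu}\otimes S^{\lambda}. \] -/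

import Mathlib

open scoped MonoidAlgebra TensorProduct

noncomputable section

namespace GenFoulkes

/-! ### Specht modules over `ℂ` -/

/-- The Young diagram of a partition of `b`. -/
def diagram {b : ℕ} (ν : b.Partition) : YoungDiagram :=
  YoungDiagram.ofRowLens (ν.parts.sort (· ≥ ·)) (ν.parts.pairwise_sort (· ≥ ·)).sortedGE

/-- The cells of the Young diagram of `ν`, as a type. A cell is a pair `(row, column)`. -/
abbrev Cell {b : ℕ} (ν : b.Partition) : Type := {c : ℕ × ℕ // c ∈ (diagram ν).cells}

/-- A `ν`-tableau: a bijective filling of the cells of `ν` with the `b` entries. -/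
abbrev Tableau {b : ℕ} (ν : b.Partition) : Type := Cell ν ≃ Fin b

/-- The row of the tableau `t` containing the entry `i`. -/
def rowOf {b : ℕ} {ν : b.Partition} (t : Tableau ν) (i : Fin b) : ℕ := (t.symm i).1.1

/-- The column of the tableau `t` containing the entry `i`. -/
def colOf {b : ℕ} {ν : b.Partition} (t : Tableau ν) (i : Fin b) : ℕ := (t.symm i).1.2

/-- The symmetric group acts on tableaux by permuting the entries. -/
def permTableau {b : ℕ} {ν : b.Partition} (σ : Equiv.Perm (Fin b)) (t : Tableau ν) : Tableau ν :=
  t.trans σ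

/-- Two tableaux are row equivalent if every entry lies in the same row of both. -/
def rowSetoid {b : ℕ} (ν : b.Partition) : Setoid (Tableau ν) where
  r t s := ∀ i, rowOf t i = rowOf s i
  iseqv := ⟨fun _ _ => rfl, fun h i => (h i).symm, fun h h' i => (h i).trans (h' i)⟩

/-- A `ν`-tabloid is a row equivalence class of `ν`-tableaux. -/
def Tabloid {b : ℕ} (ν : b.Partition) : Type := Quotient (rowSetoid ν)

/-- The tabloid `{t}` of a tableau `t`. -/
def tabloid {b : ℕ} {ν : b.Partition} (t : Tableau ν) : Tabloid ν := Quotient.mk (rowSetoid ν) t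

/-- The action of the symmetric group on tabloids, `σ • {t} = {σ t}`. -/
instance instMulActionTabloid {b : ℕ} (ν : b.Partition) :
    MulAction (Equiv.Perm (Fin b)) (Tabloid ν) where
  smul σ := Quotient.map (permTableau σ) (fun _ _ h i => h (σ.symm i))
  one_smul := by
    rintro ⟨t⟩
    rfl
  mul_smul := by
    rintro σ τ ⟨t⟩
    rfl

theorem smul_tabloid {b : ℕ} {ν : b.Partition} (σ : Equiv.Perm (Fin b)) (t : Tableau ν) :
    σ • tabloid t = tabloid (permTableau σ t) := rfl

/-- The permutation module `M^ν` of the symmetric group on the `ν`-tabloids. -/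
def tabloidRep {b : ℕ} (ν : b.Partition) :
    Representation ℂ (Equiv.Perm (Fin b)) ℂ[Tabloid ν] :=
  Representation.ofMulAction ℂ (Equiv.Perm (Fin b)) (Tabloid ν)

open Classical in
/-- The column group of the tableau `t`: the permutations that preserve each column of `t`. -/
def columnGroup {b : ℕ} {ν : b.Partition} (t : Tableau ν) : Finset (Equiv.Perm (Fin b)) :=
  Finset.univ.filter fun π => ∀ i, colOf t (π i) = colOf t i

/-- The polytabloid `e_t`, the sum of `sgn(π) {π t}` over the column group of `t`. -/
def polytabloid {b : ℕ} {ν : b.Partition} (t : Tableau ν) : ℂ[Tabloid ν] :=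
  ∑ π ∈ columnGroup t,
    MonoidAlgebra.single (tabloid (permTableau π t)) (((Equiv.Perm.sign π : ℤˣ) : ℤ) : ℂ)

theorem tabloidRep_polytabloid {b : ℕ} {ν : b.Partition} (σ : Equiv.Perm (Fin b))
    (t : Tableau ν) : tabloidRep ν σ (polytabloid t) = polytabloid (permTableau σ t) := by
  classical
  unfold polytabloid
  rw [map_sum]
  refine Finset.sum_bij' (fun π _ => σ * π * σ⁻¹) (fun π _ => σ⁻¹ * π * σ) ?_ ?_ ?_ ?_ ?_
  · intro π hπ
    simp only [columnGroup, Finset.mem_filter, Finset.mem_univ, true_and] at hπ ⊢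
    intro i
    have := hπ (σ⁻¹ i)
    simpa [colOf, permTableau] using this
  · intro π hπ
    simp only [columnGroup, Finset.mem_filter, Finset.mem_univ, true_and] at hπ ⊢
    intro i
    have := hπ (σ i)
    simpa [colOf, permTableau] using this
  · intro π _
    group
  · intro π _
    group
  · intro π _
    have h : permTableau (σ * π * σ⁻¹) (permTableau σ t) = permTableau σ (permTableau π t) := by
      ext x
      simp [permTableau]
    simp only [tabloidRep, Representation.ofMulAction_single, smul_tabloid, h]
    have hs : Equiv.Perm.sign (σ * π * σ⁻¹) = Equiv.Perm.sign π := by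
      rw [Equiv.Perm.sign_mul, Equiv.Perm.sign_mul, Equiv.Perm.sign_inv, mul_right_comm,
        Int.units_mul_self, one_mul]
    rw [hs]

/-- The Specht module `S^ν`, the submodule of `M^ν` spanned by the polytabloids. -/
def spechtSub {b : ℕ} (ν : b.Partition) : Subrepresentation (tabloidRep ν) where
  toSubmodule := Submodule.span ℂ (Set.range (polytabloid (ν := ν)))
  apply_mem_toSubmodule σ v hv := by
    induction hv using Submodule.span_induction with
    | mem x hx =>
      obtain ⟨t, rfl⟩ := hx
      rw [tabloidRep_polytabloid]
      exact Submodule.subset_span ⟨_, rfl⟩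
    | zero => simp
    | add x y _ _ hx hy => rw [map_add]; exact Submodule.add_mem _ hx hy
    | smul c x _ hx => rw [map_smul]; exact Submodule.smul_mem _ c hx

/-- The underlying vector space of the Specht module `S^ν`. -/
abbrev SpechtV {b : ℕ} (ν : b.Partition) : Type := (spechtSub ν).toSubmodule

/-- The Specht module `S^ν` as a representation of the symmetric group. -/
def specht {b : ℕ} (ν : b.Partition) : Representation ℂ (Equiv.Perm (Fin b)) (SpechtV ν) :=
  (spechtSub ν).toRepresentation

/-- The polytabloid `e_t` as an element of the Specht module. -/
def spechtPoly {b : ℕ} {ν : b.Partition} (t : Tableau ν) : SpechtV ν :=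
  ⟨polytabloid t, Submodule.subset_span ⟨t, rfl⟩⟩

/-! ### Multiplicities and Kronecker coefficients -/

/-- The multiplicity of an irreducible complex representation `σ` in a finite-dimensional
representation `τ` of a finite group: the dimension of `Hom_G(σ, τ)`. -/
def multiplicity {G V W : Type*} [Group G] [AddCommMonoid V] [Module ℂ V] [AddCommMonoid W]
    [Module ℂ W] (σ : Representation ℂ G V) (τ : Representation ℂ G W) : ℕ :=
  Module.finrank ℂ (σ.IntertwiningMap τ)

/-- The Kronecker coefficient `c^ν_{μ,λ}`: the multiplicity of `S^ν` in `S^μ ⊗ S^λ`. -/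
def kronecker {b : ℕ} (μ lam ν : b.Partition) : ℕ :=
  multiplicity (specht ν) ((specht μ).tprod (specht lam))

/-! ### Generalized Foulkes modules -/

/-- The wreath product `S_a ≀ S_b = (S_a)^b ⋊ S_b`, where `S_b` permutes the factors. -/
abbrev Wreath (a b : ℕ) : Type :=
  (Fin b → Equiv.Perm (Fin a)) ⋊[mulAutArrow (G := Equiv.Perm (Fin b)) (A := Fin b)
    (M := Equiv.Perm (Fin a))] Equiv.Perm (Fin b)

/-- The imprimitive action of `S_a ≀ S_b` on `Fin a × Fin b`: the blocks are the sets
`Fin a × {i}`, which are permuted by the top group. -/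
def wreathProdHom (a b : ℕ) : Wreath a b →* Equiv.Perm (Fin a × Fin b) where
  toFun w :=
    { toFun := fun p => (w.left (w.right p.2) p.1, w.right p.2)
      invFun := fun p => ((w.left p.2)⁻¹ p.1, w.right⁻¹ p.2)
      left_inv := fun p => by simp
      right_inv := fun p => by simp }
  map_one' := by
    ext p <;> simp
  map_mul' v w := by
    ext p
    · change ((v.left (v.right (w.right p.2)) * w.left (v.right⁻¹ (v.right (w.right p.2)))) p.1).val
        = (v.left (v.right (w.right p.2)) (w.left (w.right p.2) p.1)).val
      simp
    · simp

/-- The embedding of `S_a ≀ S_b` in `S_{ab}`. The set of `ab` points is identified with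
`Fin a × Fin b`, where `(x, i)` corresponds to `i + b x`. -/
def wreathHom (a b : ℕ) : Wreath a b →* Equiv.Perm (Fin (a * b)) :=
  (Equiv.permCongrHom finProdFinEquiv).toMonoidHom.comp (wreathProdHom a b)

/-- The inflation of the Specht module `S^ν` from `S_b` to `S_a ≀ S_b`. -/
def inflSpecht {b : ℕ} (ν : b.Partition) (a : ℕ) :
    Representation ℂ (Wreath a b) (SpechtV ν) :=
  (specht ν).comp SemidirectProduct.rightHom

/-- The underlying vector space of the generalized Foulkes module `F_ν^a`. -/
abbrev FoulkesV {b : ℕ} (ν : b.Partition) (a : ℕ) : Type :=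
  Representation.IndV (wreathHom a b) (inflSpecht ν a)

/-- The generalized Foulkes module `F_ν^a`, a representation of `S_{ab}`. -/
def foulkes {b : ℕ} (ν : b.Partition) (a : ℕ) :
    Representation ℂ (Equiv.Perm (Fin (a * b))) (FoulkesV ν a) :=
  Representation.ind (wreathHom a b) (inflSpecht ν a)

/-! ### Restriction to `S_k × S_{n-k}` and its components -/

/-- The embedding of `S_k × S_{n-k}` in `S_n`, where the first factor acts on the first `k`
points and the second factor on the last `n - k` points. -/
def youngHom {k n : ℕ} (hk : k ≤ n) :
    Equiv.Perm (Fin k) × Equiv.Perm (Fin (n - k)) →* Equiv.Perm (Fin n) :=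
  (Equiv.permCongrHom (finSumFinEquiv.trans (finCongr (Nat.add_sub_cancel' hk)))).toMonoidHom.comp
    (Equiv.Perm.sumCongrHom (Fin k) (Fin (n - k)))

/-- The `i`-th block `X_i` of the ordered set partition `X = g X⁰`, where the `i`-th block of `X⁰`
is the `i`-th block of the imprimitive action of `S_a ≀ S_b`. Every ordered partition of the `ab`
points into `b` blocks of size `a` is of this form. -/
def block {a b : ℕ} (g : Equiv.Perm (Fin (a * b))) (i : Fin b) : Finset (Fin (a * b)) :=
  Finset.univ.image fun x : Fin a => g (finProdFinEquiv (x, i))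

/-- The partition type of the restriction of `X = g X⁰` to the first `k` points: the multiset of
the sizes of the nonempty sets among the `X_i ∩ {1, …, k}`. -/
def blockType {a b : ℕ} (k : ℕ) (g : Equiv.Perm (Fin (a * b))) : Multiset ℕ :=
  ((Finset.univ : Finset (Fin b)).val.map
    fun i => ((block g i).filter fun x => x.val < k).card).filter (· ≠ 0)

/-- The element `e_{t_X} = g ⊗ e_t` of `F_ν^a`, where `X = g X⁰`. In `Representation.ind` the
tensor `g ⊗ v` is denoted `IndV.mk g⁻¹ v`. -/
def foulkesPoly {b : ℕ} {ν : b.Partition} (a : ℕ) (g : Equiv.Perm (Fin (a * b)))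
    (t : Tableau ν) : FoulkesV ν a :=
  Representation.IndV.mk (wreathHom a b) (inflSpecht ν a) g⁻¹ (spechtPoly t)

theorem foulkes_foulkesPoly {b : ℕ} {ν : b.Partition} (a : ℕ) (h g : Equiv.Perm (Fin (a * b)))
    (t : Tableau ν) : foulkes ν a h (foulkesPoly a g t) = foulkesPoly a (h * g) t := by
  unfold foulkes foulkesPoly
  rw [Representation.ind_mk, mul_inv_rev]

theorem youngHom_lt_iff {k n : ℕ} (hk : k ≤ n)
    (h : Equiv.Perm (Fin k) × Equiv.Perm (Fin (n - k))) (x : Fin n) :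
    (youngHom hk h x).val < k ↔ x.val < k := by
  obtain ⟨y, rfl⟩ := (finSumFinEquiv.trans (finCongr (Nat.add_sub_cancel' hk))).surjective x
  have key : youngHom hk h ((finSumFinEquiv.trans (finCongr (Nat.add_sub_cancel' hk))) y) =
      (finSumFinEquiv.trans (finCongr (Nat.add_sub_cancel' hk))) (Equiv.sumCongr h.1 h.2 y) := by
    simp [youngHom, Equiv.permCongrHom, Equiv.Perm.sumCongrHom, Equiv.permCongr_apply]
  rw [key]
  cases y <;> simp

theorem blockType_youngHom_mul {a b k : ℕ} (hk : k ≤ a * b)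
    (h : Equiv.Perm (Fin k) × Equiv.Perm (Fin (a * b - k))) (g : Equiv.Perm (Fin (a * b))) :
    blockType k (youngHom hk h * g) = blockType k g := by
  unfold blockType
  congr 2
  funext i
  refine (Finset.card_bij (fun x _ => youngHom hk h x) ?_ ?_ ?_).symm
  · intro x hx
    simp only [block, Finset.mem_filter, Finset.mem_image, Finset.mem_univ, true_and] at hx ⊢
    obtain ⟨⟨y, rfl⟩, hy⟩ := hx
    exact ⟨⟨y, rfl⟩, (youngHom_lt_iff hk h _).2 hy⟩
  · intro x _ y _ hxy
    exact (youngHom hk h).injective hxy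
  · intro x hx
    simp only [block, Finset.mem_filter, Finset.mem_image, Finset.mem_univ, true_and] at hx ⊢
    obtain ⟨⟨y, rfl⟩, hy⟩ := hx
    exact ⟨_, ⟨⟨y, rfl⟩, (youngHom_lt_iff hk h _).1 hy⟩, rfl⟩

/-- The restriction of `F_ν^a` to `S_k × S_{ab-k}`. -/
def foulkesRes {b : ℕ} (ν : b.Partition) (a : ℕ) {k : ℕ} (hk : k ≤ a * b) :
    Representation ℂ (Equiv.Perm (Fin k) × Equiv.Perm (Fin (a * b - k))) (FoulkesV ν a) :=
  (foulkes ν a).comp (youngHom hk)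

/-- The `lam`-component of the restriction of `F_ν^a` to `S_k × S_{ab-k}`, spanned by the `e_{t_X}`
such that the restriction of `X` to the first `k` points has type `lam`. -/
def component {b : ℕ} (ν : b.Partition) (a : ℕ) {k : ℕ} (hk : k ≤ a * b) (lam : k.Partition) :
    Subrepresentation (foulkesRes ν a hk) where
  toSubmodule := Submodule.span ℂ
    {v | ∃ (g : Equiv.Perm (Fin (a * b))) (t : Tableau ν),
      blockType k g = lam.parts ∧ v = foulkesPoly a g t}
  apply_mem_toSubmodule h v hv := by
    induction hv using Submodule.span_induction with
    | mem x hx =>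
      obtain ⟨g, t, hg, rfl⟩ := hx
      refine Submodule.subset_span ⟨youngHom hk h * g, t, ?_, foulkes_foulkesPoly a _ g t⟩
      rw [blockType_youngHom_mul, hg]
    | zero => simp
    | add x y _ _ hx hy => rw [map_add]; exact Submodule.add_mem _ hx hy
    | smul c x _ hx => rw [map_smul]; exact Submodule.smul_mem _ c hx

/-- The partition `(1^b)` of `b`. -/
def onesPartition (b : ℕ) : b.Partition where
  parts := Multiset.replicate b 1
  parts_pos hi := by
    rw [Multiset.eq_of_mem_replicate hi]
    exact one_pos
  parts_sum := by simp

/-- The underlying vector space of `U_{ν,a}`. -/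
abbrev UV {b : ℕ} (ν : b.Partition) (a : ℕ) (hb : b ≤ a * b) : Type :=
  (component ν a hb (onesPartition b)).toSubmodule

/-- `U_{ν,a}`, the `(1^b)`-component of the restriction of `F_ν^a` to `S_b × S_{ab-b}`. -/
def U {b : ℕ} (ν : b.Partition) (a : ℕ) (hb : b ≤ a * b) :
    Representation ℂ (Equiv.Perm (Fin b) × Equiv.Perm (Fin (a * b - b))) (UV ν a hb) :=
  (component ν a hb (onesPartition b)).toRepresentation

/-! ### Outer tensor products and multiplicity sums -/

/-- The outer tensor product of representations of `G` and `H`, a representation of `G × H`. -/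
def outer {G H V W : Type*} [Group G] [Group H] [AddCommMonoid V] [Module ℂ V] [AddCommMonoid W]
    [Module ℂ W] (σ : Representation ℂ G V) (τ : Representation ℂ H W) :
    Representation ℂ (G × H) (V ⊗[ℂ] W) :=
  Representation.tprod (σ.comp (MonoidHom.fst G H)) (τ.comp (MonoidHom.snd G H))

/-- A representation of `S_m` regarded as a representation of `S_n`, where `n = m`. -/
def castPerm {m n : ℕ} (h : n = m) {V : Type*} [AddCommMonoid V] [Module ℂ V]
    (τ : Representation ℂ (Equiv.Perm (Fin m)) V) : Representation ℂ (Equiv.Perm (Fin n)) V :=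
  τ.comp (Equiv.permCongrHom (finCongr h)).toMonoidHom

end GenFoulkes

end

noncomputable section

namespace Representation

section General

variable {k : Type*} [Field k] {G : Type*} [Group G]

section

variable {V W : Type*} [AddCommGroup V] [Module k V] [AddCommGroup W] [Module k W]

/-- A representation is the product of two complementary subrepresentations. -/
def prodEquivOfIsCompl {ρ : Representation k G V} (p q : Subrepresentation ρ)
    (h : IsCompl p.toSubmodule q.toSubmodule) :
    (p.toRepresentation.prod q.toRepresentation).Equiv ρ :=
  Equiv.mk (Submodule.prodEquivOfIsCompl _ _ h) fun g => by
    ext x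
    · simp [Subrepresentation.toRepresentation]
    · simp [Subrepresentation.toRepresentation]

theorem exists_isCompl_toSubmodule [CharZero k] [Finite G] {ρ : Representation k G V}
    (p : Subrepresentation ρ) :
    ∃ q : Subrepresentation ρ, IsCompl p.toSubmodule q.toSubmodule := by
  have : IsSemisimpleRepresentation ρ := inferInstance
  obtain ⟨q, hq⟩ := ComplementedLattice.exists_isCompl p
  refine ⟨q, ?_, ?_⟩
  · rw [disjoint_iff, ← Subrepresentation.toSubmodule_inf, hq.inf_eq_bot]
    rfl
  · rw [codisjoint_iff, ← Subrepresentation.toSubmodule_sup, hq.sup_eq_top]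
    rfl

/-- The product of the kernel and the range of an intertwining map of representations of a finite
group is isomorphic to its source. -/
theorem nonempty_ker_prod_range_equiv [CharZero k] [Finite G] {ρ : Representation k G V}
    {σ : Representation k G W} (f : ρ.IntertwiningMap σ) :
    Nonempty ((f.ker.toRepresentation.prod f.range.toRepresentation).Equiv ρ) := by
  obtain ⟨q, hq⟩ := exists_isCompl_toSubmodule f.ker
  let e : q.toSubmodule ≃ₗ[k] f.range.toSubmodule :=
    LinearEquiv.ofBijective
      ((f.toLinearMap.domRestrict q.toSubmodule).codRestrict f.range.toSubmodule
        fun x => ⟨x, rfl⟩) (by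
      constructor
      · rw [← LinearMap.ker_eq_bot, LinearMap.ker_eq_bot']
        intro x hx
        have h1 : (x : V) ∈ f.ker.toSubmodule := by
          exact congrArg Subtype.val hx
        have h2 := hq.disjoint.le_bot ⟨h1, x.2⟩
        exact Subtype.ext h2
      · rintro ⟨_, v, rfl⟩
        have hv : v ∈ f.ker.toSubmodule ⊔ q.toSubmodule := by
          rw [hq.sup_eq_top]; trivial
        obtain ⟨a, ha, b, hb, rfl⟩ := Submodule.mem_sup.1 hv
        have ha' : f.toLinearMap a = 0 := ha
        refine ⟨⟨b, hb⟩, Subtype.ext ?_⟩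
        change f.toLinearMap b = f.toLinearMap (a + b)
        rw [map_add, ha', zero_add])
  refine ⟨(Equiv.mk ((LinearEquiv.refl k _).prodCongr e.symm) ?_).trans
    (prodEquivOfIsCompl f.ker q hq)⟩
  intro g
  refine LinearMap.ext fun x => Prod.ext rfl ?_
  change e.symm (f.range.toRepresentation g x.2) = q.toRepresentation g (e.symm x.2)
  rw [LinearEquiv.symm_apply_eq]
  obtain ⟨y, hy⟩ := e.surjective x.2
  rw [← hy, LinearEquiv.symm_apply_apply]
  exact Subtype.ext (IntertwiningMap.isIntertwining _ _ f g y).symm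

/-- The character of a product of representations. -/
theorem char_prod [FiniteDimensional k V] [FiniteDimensional k W] (ρ : Representation k G V)
    (σ : Representation k G W) : (ρ.prod σ).character = ρ.character + σ.character := by
  ext g
  exact LinearMap.trace_prodMap' _ _

theorem card_inv_mul_sum_char [CharZero k] [Fintype G] [FiniteDimensional k V]
    [FiniteDimensional k W]
    (ρ : Representation k G V) (σ : Representation k G W) :
    (Nat.card G : k)⁻¹ * ∑ g : G, σ.character g * ρ.character g⁻¹ =
      Module.finrank k (IntertwiningMap ρ σ) := by
  have : Invertible (Nat.card G : k) := invertibleOfNonzero (NeZero.ne _)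
  exact card_inv_mul_sum_char_mul_char_eq_finrank ρ σ

end

universe u v

theorem nonempty_equiv_of_character_eq_aux [CharZero k] [Finite G] (n : ℕ) :
    ∀ {V : Type u} {W : Type v} [AddCommGroup V] [Module k V] [FiniteDimensional k V]
    [AddCommGroup W] [Module k W] [FiniteDimensional k W] (ρ : Representation k G V)
    (σ : Representation k G W), Module.finrank k V = n → ρ.character = σ.character →
    Nonempty (ρ.Equiv σ) := by
  have := Fintype.ofFinite G
  induction n using Nat.strong_induction_on with
  | _ n ih =>
  intro V W _ _ _ _ _ _ ρ σ hn h
  have hdim : Module.finrank k W = n := by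
    have := congrFun h 1
    rw [char_one, char_one, hn] at this
    exact_mod_cast this.symm
  rcases Nat.eq_zero_or_pos n with rfl | hpos
  · have hV := Module.finrank_zero_iff.1 hn
    have hW := Module.finrank_zero_iff.1 hdim
    exact ⟨Equiv.mk (LinearEquiv.ofFinrankEq _ _ (hn.trans hdim.symm)) fun g =>
      LinearMap.ext fun x => Subsingleton.elim _ _⟩
  · have hVV : Module.finrank k (IntertwiningMap ρ σ) =
        Module.finrank k (IntertwiningMap ρ ρ) := by
      have h1 := card_inv_mul_sum_char ρ σ
      rw [← h, card_inv_mul_sum_char ρ ρ] at h1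
      exact_mod_cast h1.symm
    have hV : Nontrivial V := Module.nontrivial_of_finrank_pos (hn ▸ hpos)
    have hid : IntertwiningMap.id ρ ≠ 0 := by
      obtain ⟨v, hv⟩ := exists_ne (0 : V)
      intro h0
      exact hv (by simpa using DFunLike.congr_fun h0 v)
    have : Nontrivial (IntertwiningMap ρ ρ) := ⟨_, _, hid⟩
    have hpos' : 0 < Module.finrank k (IntertwiningMap ρ σ) := hVV ▸ Module.finrank_pos
    have : Nontrivial (IntertwiningMap ρ σ) := Module.nontrivial_of_finrank_pos hpos'
    obtain ⟨f, hf⟩ := exists_ne (0 : IntertwiningMap ρ σ)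
    obtain ⟨e₁⟩ := nonempty_ker_prod_range_equiv f
    obtain ⟨q, hq⟩ := exists_isCompl_toSubmodule f.range
    have e₂ := prodEquivOfIsCompl _ _ hq
    have hchar : f.ker.toRepresentation.character = q.toRepresentation.character := by
      have h1 := char_iso e₁
      have h2 := char_iso e₂
      rw [char_prod] at h1 h2
      rw [h, ← h2, add_comm] at h1
      exact add_left_cancel h1
    have hlt : Module.finrank k f.ker.toSubmodule < n := by
      rw [← hn]
      refine Submodule.finrank_lt fun htop => hf ?_
      ext v
      have : v ∈ f.ker.toSubmodule := htop ▸ Submodule.mem_top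
      exact this
    obtain ⟨e₃⟩ := ih _ hlt f.ker.toRepresentation q.toRepresentation rfl hchar
    refine ⟨e₁.symm.trans ((Equiv.mk (((e₃.toLinearEquiv).prodCongr
      (LinearEquiv.refl k _)).trans (LinearEquiv.prodComm k _ _)) ?_).trans e₂)⟩
    intro g
    refine LinearMap.ext fun x => Prod.ext rfl ?_
    exact IntertwiningMap.isIntertwining _ _ e₃.toIntertwiningMap g x.1

/-- Finite-dimensional representations of a finite group in characteristic zero with the same
character are isomorphic. -/
theorem nonempty_equiv_of_character_eq [CharZero k] [Finite G] {V : Type u} {W : Type v}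
    [AddCommGroup V] [Module k V] [FiniteDimensional k V] [AddCommGroup W] [Module k W] [FiniteDimensional k W]
    (ρ : Representation k G V) (σ : Representation k G W) (h : ρ.character = σ.character) :
    Nonempty (ρ.Equiv σ) :=
  nonempty_equiv_of_character_eq_aux _ ρ σ rfl h

/-- The character of a finite direct sum of representations. -/
theorem char_directSum {ι : Type*} [Fintype ι] {V : ι → Type*}
    [∀ i, AddCommGroup (V i)] [∀ i, Module k (V i)] [∀ i, FiniteDimensional k (V i)]
    (ρ : ∀ i, Representation k G (V i)) (g : G) :
    (directSum ρ).character g = ∑ i, (ρ i).character g := by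
  classical
  unfold character
  change LinearMap.trace k (Π₀ i, V i) (directSum ρ g) = _
  rw [LinearMap.trace_eq_matrix_trace k
    (DFinsupp.basis fun i => Module.finBasis k (V i)), Matrix.trace, Fintype.sum_sigma]
  refine Finset.sum_congr rfl fun i _ => ?_
  rw [LinearMap.trace_eq_matrix_trace k (Module.finBasis k (V i)), Matrix.trace]
  refine Finset.sum_congr rfl fun j _ => ?_
  rw [Matrix.diag_apply, Matrix.diag_apply, LinearMap.toMatrix_apply, LinearMap.toMatrix_apply]
  simp [DirectSum.lmap, DFinsupp.basis]

section Coinvariants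

variable {V : Type*} [AddCommGroup V] [Module k V]

/-- The averaging section of the quotient map onto the coinvariants. -/
def Coinvariants.averageSection [Fintype G] (ρ : Representation k G V) : Coinvariants ρ →ₗ[k] V :=
  Coinvariants.lift ρ ((Nat.card G : k)⁻¹ • ∑ g : G, ρ g) fun x => by
    rw [LinearMap.smul_comp]
    congr 1
    rw [← Module.End.mul_eq_comp, Finset.sum_mul]
    exact Fintype.sum_equiv (Equiv.mulRight x) _ _ fun g => by simp [Module.End.mul_eq_comp]

theorem Coinvariants.averageSection_mk [Fintype G] (ρ : Representation k G V) (v : V) :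
    Coinvariants.averageSection ρ (Coinvariants.mk ρ v) = (Nat.card G : k)⁻¹ • ∑ g : G, ρ g v := by
  simp [averageSection]

theorem Coinvariants.mk_averageSection [CharZero k] [Fintype G] (ρ : Representation k G V)
    (x : Coinvariants ρ) : Coinvariants.mk ρ (Coinvariants.averageSection ρ x) = x := by
  induction x using Coinvariants.induction_on with
  | _ v =>
  rw [averageSection_mk, map_smul, map_sum]
  simp only [Coinvariants.mk_self_apply, Finset.sum_const, Finset.card_univ]
  rw [← Nat.card_eq_fintype_card, ← Nat.cast_smul_eq_nsmul k, smul_smul,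
    inv_mul_cancel₀ (NeZero.ne _), one_smul]

/-- The trace of the map induced on coinvariants by an equivariant endomorphism. -/
theorem Coinvariants.trace_map [CharZero k] [Fintype G] [FiniteDimensional k V]
    (ρ : Representation k G V) (T : ρ.IntertwiningMap ρ) :
    LinearMap.trace k _ (Coinvariants.map ρ ρ T) =
      (Nat.card G : k)⁻¹ * ∑ g : G, LinearMap.trace k V (ρ g ∘ₗ T.toLinearMap) := by
  have h1 : Coinvariants.map ρ ρ T =
      (Coinvariants.mk ρ ∘ₗ T.toLinearMap) ∘ₗ Coinvariants.averageSection ρ := by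
    refine LinearMap.ext fun x => ?_
    conv_lhs => rw [← Coinvariants.mk_averageSection ρ x]
    rfl
  rw [h1, LinearMap.trace_comp_comm', ← smul_eq_mul, ← map_sum, ← map_smul]
  congr 1
  refine LinearMap.ext fun v => ?_
  change Coinvariants.averageSection ρ (Coinvariants.mk ρ (T v)) = _
  rw [averageSection_mk]
  simp

end Coinvariants

section Induced

variable {H : Type*} [Group H]

open Classical in
theorem trace_mapDomainLinearMap {X : Type*} [Fintype X] (f : X → X) :
    LinearMap.trace k k[X] (MonoidAlgebra.mapDomainLinearMap k k f) =
      (Finset.univ.filter fun x => f x = x).card := by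
  rw [LinearMap.trace_eq_matrix_trace k (MonoidAlgebra.basis X k), Matrix.trace,
    Finset.card_filter, Nat.cast_sum]
  refine Finset.sum_congr rfl fun x _ => ?_
  rw [Matrix.diag_apply, LinearMap.toMatrix_apply]
  simp [MonoidAlgebra.basis, Finsupp.single_apply]

instance finite_monoidAlgebra {X : Type*} [Finite X] : Module.Finite k k[X] :=
  Module.Finite.of_basis (MonoidAlgebra.basis X k)

variable {V : Type*} [AddCommGroup V] [Module k V]

/-- The character of an induced representation. -/
theorem char_ind [Fintype G] [Fintype H] [CharZero k] [FiniteDimensional k V] (φ : G →* H)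
    (τ : Representation k G V) (x : H) : (ind φ τ).character x = (Nat.card G : k)⁻¹ *
      ∑ w : G, (Nat.card {g : H // φ w * g = g * x} : k) * τ.character w := by
  classical
  unfold character
  refine (Coinvariants.trace_map _ _).trans ?_
  congr 1
  refine Finset.sum_congr rfl fun w _ => ?_
  have : (tprod ((leftRegular k H).comp φ) τ) w ∘ₗ
      (MonoidAlgebra.mapDomainLinearMap k k fun y : H => y * x⁻¹).rTensor V =
      TensorProduct.map (MonoidAlgebra.mapDomainLinearMap k k fun y : H => φ w * y * x⁻¹)
        (τ w) := by
    ext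
    simp [mul_assoc]
  refine (congrArg _ this).trans ?_
  rw [LinearMap.trace_tensorProduct', trace_mapDomainLinearMap]
  rw [Nat.card_eq_fintype_card, Fintype.card_subtype]
  simp only [mul_inv_eq_iff_eq_mul]

theorem ind_mk_smul (φ : G →* H) (τ : Representation k G V) (w : G) (g : H) (v : V) :
    IndV.mk φ τ (φ w * g) (τ w v) = IndV.mk φ τ g v := by
  have := Coinvariants.mk_self_apply (tprod ((leftRegular k H).comp φ) τ) w
    ((MonoidAlgebra.single g 1) ⊗ₜ[k] v)
  simpa using this

theorem constr_single {X W : Type*} [AddCommGroup W] [Module k W] (f : X → W) (x : X) :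
    (MonoidAlgebra.basis X k).constr k f (MonoidAlgebra.single x 1) = f x := by
  rw [← MonoidAlgebra.basis_apply, Module.Basis.constr_basis]

/-- The linear map out of an induced representation given by a compatible family of maps. -/
def indLift {W : Type*} [AddCommGroup W] [Module k W] (φ : G →* H) (τ : Representation k G V)
    (f : H → V →ₗ[k] W) (hf : ∀ w g v, f (φ w * g) (τ w v) = f g v) : IndV φ τ →ₗ[k] W :=
  Coinvariants.lift _ (TensorProduct.lift ((MonoidAlgebra.basis H k).constr k f)) fun u => by
    ext g v
    simp only [TensorProduct.AlgebraTensorModule.curry_apply, LinearMap.restrictScalars_self,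
      TensorProduct.curry_apply, LinearMap.coe_comp, Function.comp_apply,
      MonoidAlgebra.lsingle_apply, tprod_apply, TensorProduct.map_tmul, TensorProduct.lift.tmul,
      MonoidHom.coe_comp, ofMulAction_single, smul_eq_mul, constr_single, hf]

theorem indLift_mk {W : Type*} [AddCommGroup W] [Module k W] (φ : G →* H)
    (τ : Representation k G V) (f : H → V →ₗ[k] W)
    (hf : ∀ w g v, f (φ w * g) (τ w v) = f g v) (g : H) (v : V) :
    indLift φ τ f hf (IndV.mk φ τ g v) = f g v := by
  simp only [indLift, LinearMap.coe_comp, Function.comp_apply, Coinvariants.lift_mk,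
    TensorProduct.mk_apply, TensorProduct.lift.tmul, constr_single]

open Classical in
/-- Elements of the induced representation, viewed as equivariant functions. -/
def indEval [Fintype G] (φ : G →* H) (τ : Representation k G V) (x : H) : IndV φ τ →ₗ[k] V :=
  indLift φ τ (fun g => ∑ w : G, if φ w * g = x then τ w else 0) fun u g v => by
    simp only [LinearMap.sum_apply, apply_ite (fun f : V →ₗ[k] V => f (τ u v)),
      apply_ite (fun f : V →ₗ[k] V => f v), LinearMap.zero_apply]
    exact Fintype.sum_equiv (Equiv.mulRight u) _ _ fun w => by simp [mul_assoc]

open Classical in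
theorem indEval_mk [Fintype G] (φ : G →* H) (τ : Representation k G V) (x g : H) (v : V) :
    indEval φ τ x (IndV.mk φ τ g v) = ∑ w : G, if φ w * g = x then τ w v else 0 := by
  rw [indEval, indLift_mk, LinearMap.sum_apply]
  exact Finset.sum_congr rfl fun w _ => by split_ifs <;> simp

theorem eq_zero_of_indEval_eq_zero [Fintype G] [Fintype H] [CharZero k] (φ : G →* H)
    (τ : Representation k G V) (z : IndV φ τ) (h : ∀ x, indEval φ τ x z = 0) : z = 0 := by
  classical
  have key : (∑ x : H, IndV.mk φ τ x ∘ₗ indEval φ τ x) = (Nat.card G : k) • LinearMap.id := by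
    refine IndV.hom_ext φ τ fun g => LinearMap.ext fun v => ?_
    suffices ∑ x : H, IndV.mk φ τ x (indEval φ τ x (IndV.mk φ τ g v)) =
        (Nat.card G : k) • IndV.mk φ τ g v by
      rw [LinearMap.comp_apply, LinearMap.sum_apply]
      exact this
    simp only [indEval_mk, map_sum]
    rw [Finset.sum_comm]
    have : ∀ w : G, ∑ x : H, IndV.mk φ τ x (if φ w * g = x then τ w v else 0) =
        IndV.mk φ τ g v := fun w => by
      rw [Finset.sum_eq_single (φ w * g)]
      · rw [if_pos rfl, ind_mk_smul]
      · intro x _ hx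
        rw [if_neg hx.symm, map_zero]
      · simp
    rw [Finset.sum_congr rfl fun w _ => this w, Finset.sum_const, Finset.card_univ,
      ← Nat.card_eq_fintype_card, Nat.cast_smul_eq_nsmul]
  have h2 := LinearMap.congr_fun key z
  simp only [LinearMap.sum_apply, LinearMap.comp_apply, h, map_zero, Finset.sum_const_zero,
    LinearMap.smul_apply, LinearMap.id_apply] at h2
  exact (smul_eq_zero.1 h2.symm).resolve_left (NeZero.ne _)

end Induced

end General

end Representation

namespace GenFoulkes

open Representation

variable {b : ℕ}

/-! ### Young diagrams of partitions -/

theorem card_cellsOfRowLens (w : List ℕ) : (YoungDiagram.cellsOfRowLens w).card = w.sum := by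
  induction w with
  | nil => rfl
  | cons a w ih =>
    rw [YoungDiagram.cellsOfRowLens, Finset.card_union_of_disjoint, Finset.card_map, ih]
    · simp
    · rw [Finset.disjoint_left]
      rintro ⟨i, j⟩ h1 h2
      simp only [Finset.mem_product, Finset.mem_singleton, Finset.mem_map] at h1 h2
      obtain ⟨⟨x, y⟩, -, h⟩ := h2
      have := congrArg Prod.fst h
      simp [h1.1] at this

theorem card_cells_diagram (ν : b.Partition) : (diagram ν).cells.card = b := by
  refine (card_cellsOfRowLens _).trans ?_
  rw [← Multiset.sum_coe, Multiset.sort_eq, ν.parts_sum]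

theorem diagram_injective : Function.Injective (diagram (b := b)) := by
  intro μ ν h
  have key : ∀ ν : b.Partition, (diagram ν).rowLens = ν.parts.sort (· ≥ ·) := fun ν =>
    YoungDiagram.rowLens_ofRowLens_eq_self fun x hx =>
      ν.parts_pos ((Multiset.mem_sort (· ≥ ·)).1 hx)
  have h2 := (key μ).symm.trans ((congrArg _ h).trans (key ν))
  ext1
  rw [← Multiset.sort_eq μ.parts (· ≥ ·), h2, Multiset.sort_eq]

instance nonempty_tableau (ν : b.Partition) : Nonempty (Tableau ν) :=
  ⟨Fintype.equivOfCardEq (by rw [Fintype.card_coe, card_cells_diagram, Fintype.card_fin])⟩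

instance finite_tabloid (ν : b.Partition) : Finite (Tabloid ν) :=
  inferInstanceAs (Finite (Quotient _))

/-- The number of entries in the rows of index less than `k`. -/
def rowCount {ν : b.Partition} (t : Tableau ν) (k : ℕ) : ℕ :=
  (Finset.univ.filter fun x => rowOf t x < k).card

theorem rowCount_eq {ν : b.Partition} (t : Tableau ν) (k : ℕ) :
    rowCount t k = ((diagram ν).cells.filter fun c => c.1 < k).card := by
  refine Finset.card_bij (fun x _ => (t.symm x).1) ?_ ?_ ?_
  · intro x hx
    exact Finset.mem_filter.2 ⟨(t.symm x).2, (Finset.mem_filter.1 hx).2⟩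
  · intro x _ y _ h
    exact t.symm.injective (Subtype.ext h)
  · intro c hc
    rw [Finset.mem_filter] at hc
    exact ⟨t ⟨c, hc.1⟩, Finset.mem_filter.2 ⟨Finset.mem_univ _, by simpa [rowOf] using hc.2⟩,
      by simp⟩

theorem eq_of_rowCount_eq {μ ν : b.Partition} (s : Tableau μ) (t : Tableau ν)
    (h : ∀ k, rowCount s k = rowCount t k) : μ = ν := by
  apply diagram_injective
  have key : ∀ (D : YoungDiagram) (i : ℕ), (D.cells.filter fun c => c.1 < i + 1).card =
      (D.cells.filter fun c => c.1 < i).card + D.rowLen i := by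
    intro D i
    rw [YoungDiagram.rowLen_eq_card, ← Finset.card_union_of_disjoint]
    · congr 1
      ext c
      simp only [Finset.mem_filter, Finset.mem_union, YoungDiagram.mem_row_iff,
        YoungDiagram.mem_cells, ← and_or_left]
      rw [Nat.lt_succ_iff_lt_or_eq]
    · rw [Finset.disjoint_left]
      intro c h1 h2
      have := (Finset.mem_filter.1 h1).2
      have := (YoungDiagram.mem_row_iff.1 h2).2
      omega
  have hrow : ∀ i, (diagram μ).rowLen i = (diagram ν).rowLen i := by
    intro i
    have h1 := key (diagram μ) i
    have h2 := key (diagram ν) i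
    rw [← rowCount_eq s, ← rowCount_eq s, h, h] at h1
    rw [← rowCount_eq t, ← rowCount_eq t] at h2
    omega
  ext ⟨i, j⟩
  rw [YoungDiagram.mem_cells, YoungDiagram.mem_cells, YoungDiagram.mem_iff_lt_rowLen,
    YoungDiagram.mem_iff_lt_rowLen, hrow]

/-! ### Pairs of tableaux such that no two entries share a row of one and a column of the other -/

/-- The number of entries in column `j` of `t` and in the rows of `s` of index less than `k`. -/
def rowColCount {μ ν : b.Partition} (s : Tableau μ) (t : Tableau ν) (k j : ℕ) : ℕ :=
  (Finset.univ.filter fun x => rowOf s x < k ∧ colOf t x = j).card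

theorem rowColCount_succ {μ ν : b.Partition} (s : Tableau μ) (t : Tableau ν) (k j : ℕ) :
    rowColCount s t (k + 1) j = rowColCount s t k j +
      (Finset.univ.filter fun x => rowOf s x = k ∧ colOf t x = j).card := by
  unfold rowColCount
  rw [← Finset.card_union_of_disjoint]
  · congr 1
    ext x
    simp only [Finset.mem_filter, Finset.mem_union, Finset.mem_univ, true_and, ← or_and_right]
    rw [Nat.lt_succ_iff_lt_or_eq]
  · rw [Finset.disjoint_left]
    intro c h1 h2
    have := (Finset.mem_filter.1 h1).2.1
    have := (Finset.mem_filter.1 h2).2.1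
    omega

theorem sum_rowColCount {μ ν : b.Partition} (s : Tableau μ) (t : Tableau ν) (k : ℕ) :
    ∑ j ∈ Finset.univ.image (colOf t), rowColCount s t k j = rowCount s k := by
  unfold rowCount
  rw [Finset.card_eq_sum_card_fiberwise (f := colOf t) (t := Finset.univ.image (colOf t))]
  · simp only [Finset.filter_filter]
    rfl
  · intro x _
    exact Finset.mem_coe.2 (Finset.mem_image_of_mem _ (Finset.mem_univ x))

theorem rowColCount_le {μ ν : b.Partition} (s : Tableau μ) (t : Tableau ν)
    (hst : Function.Injective fun x => (rowOf s x, colOf t x)) (k j : ℕ) :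
    rowColCount s t k j ≤ rowColCount t t k j := by
  by_cases h : ∃ x, colOf t x = j ∧ k ≤ rowOf t x
  · obtain ⟨x, hx, hk⟩ := h
    have h1 : rowColCount s t k j ≤ k := by
      conv_rhs => rw [← Finset.card_range k]
      refine Finset.card_le_card_of_injOn (rowOf s) ?_ ?_
      · intro y hy
        exact Finset.mem_coe.2 (Finset.mem_range.2 (Finset.mem_filter.1 hy).2.1)
      · intro y hy z hz hyz
        exact hst (Prod.ext hyz ((Finset.mem_filter.1 hy).2.2.trans
          (Finset.mem_filter.1 hz).2.2.symm))
    refine h1.trans ?_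
    have hmem : ∀ r < k, (r, j) ∈ (diagram ν).cells := by
      intro r hr
      have := (t.symm x).2
      exact (diagram ν).up_left_mem (hr.le.trans hk) hx.ge this
    conv_lhs => rw [← Finset.card_range k]
    rw [← Finset.card_attach]
    refine Finset.card_le_card_of_injOn
      (fun r => t ⟨(r.1, j), hmem r.1 (Finset.mem_range.1 r.2)⟩) ?_ ?_
    · intro r _
      have := Finset.mem_range.1 r.2
      exact Finset.mem_coe.2 (Finset.mem_filter.2 ⟨Finset.mem_univ _, by simpa [rowOf, colOf]⟩)
    · intro r _ r' _ h
      have := congrArg (fun c : Cell ν => c.1.1) (t.injective h)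
      exact Subtype.ext this
  · push Not at h
    refine Finset.card_le_card fun x hx => ?_
    have := (Finset.mem_filter.1 hx).2.2
    exact Finset.mem_filter.2 ⟨Finset.mem_univ _, h x this, this⟩

theorem rowCount_le {μ ν : b.Partition} (s : Tableau μ) (t : Tableau ν)
    (hst : Function.Injective fun x => (rowOf s x, colOf t x)) (k : ℕ) :
    rowCount s k ≤ rowCount t k := by
  rw [← sum_rowColCount s t, ← sum_rowColCount t t]
  exact Finset.sum_le_sum fun j _ => rowColCount_le s t hst k j

theorem perm_apply_inv (π : Equiv.Perm (Fin b)) (i : Fin b) : π (π⁻¹ i) = i :=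
  π.apply_symm_apply i

theorem mem_columnGroup {ν : b.Partition} {t : Tableau ν} {π : Equiv.Perm (Fin b)} :
    π ∈ columnGroup t ↔ ∀ i, colOf t (π i) = colOf t i := by
  classical
  simp [columnGroup]

/-- Two tableaux of the same shape such that no two entries share a row of one and a column of the
other have the same rows up to a column permutation. -/
theorem exists_mem_columnGroup {ν : b.Partition} (s t : Tableau ν)
    (hst : Function.Injective fun x => (rowOf s x, colOf t x)) :
    ∃ π ∈ columnGroup t, tabloid s = tabloid (permTableau π t) := by
  have hcount : ∀ k, ∀ j ∈ Finset.univ.image (colOf t),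
      rowColCount s t k j = rowColCount t t k j := by
    intro k
    rw [← Finset.sum_eq_sum_iff_of_le fun j _ => rowColCount_le s t hst k j,
      sum_rowColCount, sum_rowColCount, rowCount_eq, rowCount_eq]
  have hex : ∀ x, ∃ y, rowOf t y = rowOf s x ∧ colOf t y = colOf t x := by
    intro x
    have h1 := rowColCount_succ s t (rowOf s x) (colOf t x)
    have h2 := rowColCount_succ t t (rowOf s x) (colOf t x)
    have hx := Finset.mem_image_of_mem (colOf t) (Finset.mem_univ x)
    rw [hcount _ _ hx, hcount _ _ hx, h2, Nat.add_left_cancel_iff] at h1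
    have hpos : 0 < (Finset.univ.filter fun y =>
        rowOf s y = rowOf s x ∧ colOf t y = colOf t x).card :=
      Finset.card_pos.2 ⟨x, by simp⟩
    rw [← h1] at hpos
    obtain ⟨y, hy⟩ := Finset.card_pos.1 hpos
    exact ⟨y, (Finset.mem_filter.1 hy).2⟩
  choose h hr hc using hex
  have hinj : Function.Injective h := by
    intro x y hxy
    exact hst (Prod.ext ((hr x).symm.trans (hxy ▸ hr y)) ((hc x).symm.trans (hxy ▸ hc y)))
  let π : Equiv.Perm (Fin b) := Equiv.ofBijective h (Finite.injective_iff_bijective.1 hinj)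
  refine ⟨π⁻¹, mem_columnGroup.2 fun i => ?_, Quotient.sound fun i => ?_⟩
  · have := hc (π⁻¹ i)
    change colOf t (π (π⁻¹ i)) = _ at this
    rw [← this, perm_apply_inv]
  · exact (hr i).symm

/-! ### Column antisymmetrizers -/

section Kappa

variable {V W : Type*} [AddCommGroup V] [Module ℂ V] [AddCommGroup W] [Module ℂ W]

/-- The signed column sum of a tableau, acting on a representation. -/
def colSum {ν : b.Partition} (t : Tableau ν) (ρ : Representation ℂ (Equiv.Perm (Fin b)) V) :
    V →ₗ[ℂ] V :=
  ∑ π ∈ columnGroup t, (((Equiv.Perm.sign π : ℤˣ) : ℤ) : ℂ) • ρ π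

theorem colSum_apply {ν : b.Partition} (t : Tableau ν)
    (ρ : Representation ℂ (Equiv.Perm (Fin b)) V) (v : V) :
    colSum t ρ v = ∑ π ∈ columnGroup t, (((Equiv.Perm.sign π : ℤˣ) : ℤ) : ℂ) • ρ π v := by
  simp [colSum]

theorem colSum_comm {ν : b.Partition} (t : Tableau ν)
    {ρ : Representation ℂ (Equiv.Perm (Fin b)) V} {σ : Representation ℂ (Equiv.Perm (Fin b)) W}
    (f : ρ.IntertwiningMap σ) (v : V) : f (colSum t ρ v) = colSum t σ (f v) := by
  rw [colSum_apply, colSum_apply, map_sum]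
  refine Finset.sum_congr rfl fun π _ => ?_
  rw [map_smul, IntertwiningMap.isIntertwining]

theorem sign_mul_self (π : Equiv.Perm (Fin b)) :
    (((Equiv.Perm.sign π : ℤˣ) : ℤ) : ℂ) * (((Equiv.Perm.sign π : ℤˣ) : ℤ) : ℂ) = 1 := by
  rcases Int.units_eq_one_or (Equiv.Perm.sign π) with h | h <;> simp [h]

theorem colSum_apply_mem {ν : b.Partition} (t : Tableau ν)
    (ρ : Representation ℂ (Equiv.Perm (Fin b)) V) {π : Equiv.Perm (Fin b)}
    (hπ : π ∈ columnGroup t) (v : V) :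
    colSum t ρ (ρ π v) = (((Equiv.Perm.sign π : ℤˣ) : ℤ) : ℂ) • colSum t ρ v := by
  rw [colSum_apply, colSum_apply, Finset.smul_sum]
  rw [mem_columnGroup] at hπ
  refine Finset.sum_bij' (fun τ _ => τ * π) (fun τ _ => τ * π⁻¹) ?_ ?_ ?_ ?_ ?_
  · intro τ hτ
    rw [mem_columnGroup] at hτ ⊢
    intro i
    rw [Equiv.Perm.mul_apply, hτ, hπ]
  · intro τ hτ
    rw [mem_columnGroup] at hτ ⊢
    intro i
    rw [Equiv.Perm.mul_apply, hτ, ← hπ, perm_apply_inv]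
  · intro τ _
    group
  · intro τ _
    group
  · intro τ _
    rw [smul_smul, map_mul, map_mul, Units.val_mul, Int.cast_mul, mul_left_comm, sign_mul_self,
      mul_one]
    rfl

theorem apply_colSum {ν : b.Partition} (t : Tableau ν)
    (ρ : Representation ℂ (Equiv.Perm (Fin b)) V) {π : Equiv.Perm (Fin b)}
    (hπ : π ∈ columnGroup t) (v : V) :
    ρ π (colSum t ρ v) = (((Equiv.Perm.sign π : ℤˣ) : ℤ) : ℂ) • colSum t ρ v := by
  rw [colSum_apply, Finset.smul_sum, map_sum]
  rw [mem_columnGroup] at hπ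
  refine Finset.sum_bij' (fun τ _ => π * τ) (fun τ _ => π⁻¹ * τ) ?_ ?_ ?_ ?_ ?_
  · intro τ hτ
    rw [mem_columnGroup] at hτ ⊢
    intro i
    rw [Equiv.Perm.mul_apply, hπ, hτ]
  · intro τ hτ
    rw [mem_columnGroup] at hτ ⊢
    intro i
    rw [Equiv.Perm.mul_apply, ← hπ, perm_apply_inv, hτ]
  · intro τ _
    group
  · intro τ _
    group
  · intro τ _
    rw [smul_smul, map_mul, map_mul, Units.val_mul, Int.cast_mul, ← mul_assoc, sign_mul_self,
      one_mul, map_smul]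
    rfl

theorem colSum_colSum {ν : b.Partition} (t : Tableau ν)
    (ρ : Representation ℂ (Equiv.Perm (Fin b)) V) (v : V) :
    colSum t ρ (colSum t ρ v) = ((columnGroup t).card : ℂ) • colSum t ρ v := by
  conv_lhs => rw [colSum_apply]
  rw [Finset.sum_congr rfl fun π hπ => by rw [apply_colSum t ρ hπ, smul_smul, sign_mul_self,
    one_smul], Finset.sum_const, Nat.cast_smul_eq_nsmul]

theorem card_columnGroup_ne_zero {ν : b.Partition} (t : Tableau ν) :
    ((columnGroup t).card : ℂ) ≠ 0 :=
  Nat.cast_ne_zero.2 (Finset.card_ne_zero_of_mem (mem_columnGroup.2 fun _ => rfl :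
    (1 : Equiv.Perm (Fin b)) ∈ columnGroup t))

end Kappa

theorem polytabloid_eq_colSum {ν : b.Partition} (t : Tableau ν) :
    polytabloid t = colSum t (tabloidRep ν) (MonoidAlgebra.single (tabloid t) 1) := by
  rw [colSum_apply, polytabloid]
  refine Finset.sum_congr rfl fun π _ => ?_
  rw [tabloidRep, ofMulAction_single, smul_tabloid, MonoidAlgebra.smul_single, smul_eq_mul, mul_one]

theorem colSum_polytabloid {ν : b.Partition} (t : Tableau ν) :
    colSum t (tabloidRep ν) (polytabloid t) = ((columnGroup t).card : ℂ) • polytabloid t := by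
  rw [polytabloid_eq_colSum, colSum_colSum]

/-- If two entries share a row of `s` and a column of `t`, then the column antisymmetrizer of `t`
annihilates the tabloid of `s`. -/
theorem colSum_tabloid_eq_zero {μ ν : b.Partition} (s : Tableau μ) (t : Tableau ν)
    (hst : ¬ Function.Injective fun x => (rowOf s x, colOf t x)) :
    colSum t (tabloidRep μ) (MonoidAlgebra.single (tabloid s) 1) = 0 := by
  simp only [Function.Injective, not_forall] at hst
  obtain ⟨x, y, hxy, hne⟩ := hst
  obtain ⟨hr, hc⟩ := Prod.ext_iff.1 hxy
  dsimp only at hr hc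
  have hmem : Equiv.swap x y ∈ columnGroup t := by
    rw [mem_columnGroup]
    intro i
    by_cases h1 : i = x
    · rw [h1, Equiv.swap_apply_left, hc]
    · by_cases h2 : i = y
      · rw [h2, Equiv.swap_apply_right, hc]
      · rw [Equiv.swap_apply_of_ne_of_ne h1 h2]
  have hfix : tabloidRep μ (Equiv.swap x y) (MonoidAlgebra.single (tabloid s) 1) =
      MonoidAlgebra.single (tabloid s) 1 := by
    rw [tabloidRep, ofMulAction_single, smul_tabloid]
    congr 1
    refine Quotient.sound fun i => ?_
    change rowOf s ((Equiv.swap x y).symm i) = rowOf s i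
    rw [Equiv.symm_swap]
    by_cases h1 : i = x
    · rw [h1, Equiv.swap_apply_left, hr]
    · by_cases h2 : i = y
      · rw [h2, Equiv.swap_apply_right, hr]
      · rw [Equiv.swap_apply_of_ne_of_ne h1 h2]
  have h := colSum_apply_mem t (tabloidRep μ) hmem (MonoidAlgebra.single (tabloid s) 1)
  rw [hfix, Equiv.Perm.sign_swap hne] at h
  rw [Units.val_neg, Units.val_one, Int.cast_neg, Int.cast_one, neg_smul, one_smul] at h
  rw [eq_neg_iff_add_eq_zero, ← two_smul ℂ] at h
  exact (smul_eq_zero.1 h).resolve_left two_ne_zero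

theorem colSum_tabloid_mem_span {ν : b.Partition} (s t : Tableau ν) :
    colSum t (tabloidRep ν) (MonoidAlgebra.single (tabloid s) 1) ∈
      Submodule.span ℂ {polytabloid t} := by
  by_cases hst : Function.Injective fun x => (rowOf s x, colOf t x)
  · obtain ⟨π, hπ, h⟩ := exists_mem_columnGroup s t hst
    have : MonoidAlgebra.single (tabloid s) (1 : ℂ) =
        tabloidRep ν π (MonoidAlgebra.single (tabloid t) 1) := by
      rw [tabloidRep, ofMulAction_single, smul_tabloid, h]
    rw [this, colSum_apply_mem t _ hπ, ← polytabloid_eq_colSum]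
    exact Submodule.smul_mem _ _ (Submodule.mem_span_singleton_self _)
  · rw [colSum_tabloid_eq_zero s t hst]
    exact zero_mem _

theorem span_tabloid (ν : b.Partition) :
    Submodule.span ℂ (Set.range fun s : Tableau ν => MonoidAlgebra.single (tabloid s) (1 : ℂ)) =
      ⊤ := by
  have := (MonoidAlgebra.basis (Tabloid ν) ℂ).span_eq
  rw [← this]
  congr 1
  ext v
  constructor
  · rintro ⟨s, rfl⟩
    exact ⟨tabloid s, rfl⟩
  · rintro ⟨⟨s⟩, rfl⟩
    exact ⟨s, rfl⟩

theorem colSum_mem_span {ν : b.Partition} (t : Tableau ν) (v : ℂ[Tabloid ν]) :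
    colSum t (tabloidRep ν) v ∈ Submodule.span ℂ {polytabloid t} := by
  have hv : v ∈ Submodule.span ℂ
      (Set.range fun s : Tableau ν => MonoidAlgebra.single (tabloid s) (1 : ℂ)) := by
    rw [span_tabloid]; trivial
  induction hv using Submodule.span_induction with
  | mem x hx =>
    obtain ⟨s, rfl⟩ := hx
    exact colSum_tabloid_mem_span s t
  | zero => rw [map_zero]; exact zero_mem _
  | add x y _ _ hx hy => rw [map_add]; exact add_mem hx hy
  | smul c x _ hx => rw [map_smul]; exact Submodule.smul_mem _ c hx

theorem rowCount_le_of_colSum_ne_zero {μ ν : b.Partition} (s : Tableau μ) (t : Tableau ν)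
    (h : colSum t (tabloidRep μ) ≠ 0) (k : ℕ) : rowCount s k ≤ rowCount t k := by
  contrapose! h
  refine LinearMap.ext_on_range (span_tabloid μ) fun s' => ?_
  refine colSum_tabloid_eq_zero s' t fun hinj => ?_
  have := rowCount_le s' t hinj k
  rw [rowCount_eq s', ← rowCount_eq s] at this
  omega

theorem polytabloid_ne_zero {ν : b.Partition} (t : Tableau ν) : polytabloid t ≠ 0 := by
  classical
  intro h
  have h1 := congrArg (fun v : ℂ[Tabloid ν] => v.coeff (tabloid t)) h
  simp only [polytabloid, MonoidAlgebra.coeff_sum, MonoidAlgebra.coeff_single,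
    Finsupp.finsetSum_apply, MonoidAlgebra.coeff_zero, Finsupp.coe_zero, Pi.zero_apply] at h1
  rw [Finset.sum_eq_single 1] at h1
  · have : tabloid (permTableau 1 t) = tabloid t := rfl
    simp [this] at h1
  · intro π hπ hne
    rw [Finsupp.single_eq_of_ne]
    intro heq
    apply hne
    have hrow : ∀ i, rowOf t i = rowOf t (π.symm i) := Quotient.exact heq
    rw [mem_columnGroup] at hπ
    ext i
    have h2 := hrow (π i)
    rw [Equiv.symm_apply_apply] at h2
    have : t.symm (π i) = t.symm i := Subtype.ext (Prod.ext h2 (hπ i))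
    rw [t.symm.injective this]
    rfl
  · intro h0
    exact absurd (mem_columnGroup.2 fun i => rfl) h0

/-! ### Intertwining maps between Specht modules -/

theorem specht_apply_spechtPoly {ν : b.Partition} (σ : Equiv.Perm (Fin b)) (t : Tableau ν) :
    specht ν σ (spechtPoly t) = spechtPoly (permTableau σ t) :=
  Subtype.ext (tabloidRep_polytabloid σ t)

theorem span_spechtPoly (ν : b.Partition) :
    Submodule.span ℂ (Set.range (spechtPoly (ν := ν))) = ⊤ := by
  have := Submodule.span_span_coe_preimage (R := ℂ) (s := Set.range (polytabloid (ν := ν)))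
  refine Eq.trans ?_ this
  congr 1
  ext v
  constructor
  · rintro ⟨t, rfl⟩
    exact ⟨t, rfl⟩
  · rintro ⟨t, ht⟩
    exact ⟨t, Subtype.ext ht⟩

/-- The inclusion of the Specht module in the tabloid module. -/
def spechtIncl (ν : b.Partition) : (specht ν).IntertwiningMap (tabloidRep ν) :=
  ⟨(spechtSub ν).toSubmodule.subtype, fun _ => rfl⟩

theorem coe_colSum {ν μ : b.Partition} (t : Tableau ν) (v : SpechtV μ) :
    ((colSum t (specht μ) v : SpechtV μ) : ℂ[Tabloid μ]) = colSum t (tabloidRep μ) v :=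
  colSum_comm t (spechtIncl μ) v

theorem colSum_spechtPoly {ν : b.Partition} (t : Tableau ν) :
    colSum t (specht ν) (spechtPoly t) = ((columnGroup t).card : ℂ) • spechtPoly t :=
  Subtype.ext ((coe_colSum t _).trans (colSum_polytabloid t))

theorem exists_map_spechtPoly_ne_zero {μ ν : b.Partition}
    {f : (specht μ).IntertwiningMap (specht ν)} (hf : f ≠ 0) (t : Tableau μ) :
    f (spechtPoly t) ≠ 0 := by
  intro h
  apply hf
  apply IntertwiningMap.toLinearMap_injective
  refine LinearMap.ext_on_range (span_spechtPoly μ) fun s => ?_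
  have hs : spechtPoly s = specht μ (t.symm.trans s) (spechtPoly t) := by
    rw [specht_apply_spechtPoly]
    congr 1
    ext x
    simp [permTableau]
  change f (spechtPoly s) = 0
  rw [hs, IntertwiningMap.isIntertwining, h, map_zero]

theorem rowCount_le_of_ne_zero {μ ν : b.Partition} {f : (specht μ).IntertwiningMap (specht ν)}
    (hf : f ≠ 0) (t : Tableau μ) (s : Tableau ν) (k : ℕ) : rowCount s k ≤ rowCount t k := by
  refine rowCount_le_of_colSum_ne_zero s t (fun h => ?_) k
  refine smul_ne_zero (card_columnGroup_ne_zero t) (exists_map_spechtPoly_ne_zero hf t) ?_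
  rw [← map_smul, ← colSum_spechtPoly, colSum_comm]
  refine Subtype.ext ?_
  rw [coe_colSum, h]
  rfl

theorem finrank_specht_self (ν : b.Partition) :
    Module.finrank ℂ ((specht ν).IntertwiningMap (specht ν)) = 1 := by
  obtain ⟨t⟩ := nonempty_tableau ν
  have hid : IntertwiningMap.id (specht ν) ≠ 0 := by
    intro h
    exact polytabloid_ne_zero t (congrArg Subtype.val (DFunLike.congr_fun h (spechtPoly t)))
  refine finrank_eq_one (IntertwiningMap.id (specht ν)) ?_ fun f => ?_
  · exact hid
  have h1 : colSum t (specht ν) (f (spechtPoly t)) =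
      ((columnGroup t).card : ℂ) • f (spechtPoly t) := by
    rw [← colSum_comm, colSum_spechtPoly, map_smul]
  have h2 := colSum_mem_span t ((f (spechtPoly t) : SpechtV ν) : ℂ[Tabloid ν])
  rw [← coe_colSum, h1] at h2
  obtain ⟨c, hc⟩ := Submodule.mem_span_singleton.1 h2
  refine ⟨((columnGroup t).card : ℂ)⁻¹ * c, ?_⟩
  by_contra hne
  refine exists_map_spechtPoly_ne_zero (sub_ne_zero.2 hne) t ?_
  have h3 : c • spechtPoly t = ((columnGroup t).card : ℂ) • f (spechtPoly t) := Subtype.ext hc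
  change (((columnGroup t).card : ℂ)⁻¹ * c) • spechtPoly t - f (spechtPoly t) = 0
  rw [mul_smul, h3, smul_smul, inv_mul_cancel₀ (card_columnGroup_ne_zero t), one_smul, sub_self]

variable {b : ℕ}

/-! ### Orthogonality of the characters of Specht modules -/

theorem character_inv {V : Type*} [AddCommGroup V] [Module ℂ V]
    (ρ : Representation ℂ (Equiv.Perm (Fin b)) V) (g : Equiv.Perm (Fin b)) :
    ρ.character g⁻¹ = ρ.character g := by
  have h : IsConj g g⁻¹ := by
    rw [Equiv.Perm.isConj_iff_cycleType_eq, Equiv.Perm.cycleType_inv]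
  obtain ⟨c, hc⟩ := isConj_iff.1 h
  rw [← hc, char_conj]

theorem sum_char_mul_char {V W : Type*} [AddCommGroup V] [Module ℂ V] [FiniteDimensional ℂ V]
    [AddCommGroup W] [Module ℂ W] [FiniteDimensional ℂ W]
    (ρ : Representation ℂ (Equiv.Perm (Fin b)) V) (σ : Representation ℂ (Equiv.Perm (Fin b)) W) :
    (Nat.card (Equiv.Perm (Fin b)) : ℂ)⁻¹ * ∑ g, ρ.character g * σ.character g =
      Module.finrank ℂ (ρ.IntertwiningMap σ) := by
  rw [← card_inv_mul_sum_char]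
  congr 1
  exact Finset.sum_congr rfl fun g _ => by rw [character_inv, mul_comm]

/-- Orthonormality of the characters of the Specht modules. -/
theorem sum_char_specht_mul_char_specht (μ ν : b.Partition) :
    (Nat.card (Equiv.Perm (Fin b)) : ℂ)⁻¹ *
      ∑ g, (specht μ).character g * (specht ν).character g = if μ = ν then 1 else 0 := by
  split_ifs with h
  · subst h
    rw [sum_char_mul_char, finrank_specht_self, Nat.cast_one]
  · by_contra hne
    have key : ∀ {μ ν : b.Partition}, (Nat.card (Equiv.Perm (Fin b)) : ℂ)⁻¹ *
        ∑ g, (specht μ).character g * (specht ν).character g ≠ 0 →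
        ∃ f : (specht μ).IntertwiningMap (specht ν), f ≠ 0 := by
      intro μ ν h
      rw [sum_char_mul_char] at h
      have := Module.nontrivial_of_finrank_pos (Nat.pos_of_ne_zero (Nat.cast_ne_zero.1 h))
      exact exists_ne _
    obtain ⟨f, hf⟩ := key hne
    obtain ⟨f', hf'⟩ := key (μ := ν) (ν := μ) (by simpa only [mul_comm] using hne)
    obtain ⟨s⟩ := nonempty_tableau μ
    obtain ⟨t⟩ := nonempty_tableau ν
    exact h (eq_of_rowCount_eq s t fun k =>
      (rowCount_le_of_ne_zero hf' t s k).antisymm (rowCount_le_of_ne_zero hf s t k))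

theorem card_partition_fin :
    Fintype.card b.Partition = Fintype.card (Fintype.card (Fin b)).Partition := by
  rw [Fintype.card_fin]

/-- Class functions on the symmetric group are combinations of the characters of the Specht
modules. -/
theorem sum_char_specht_mul_sum (f : Equiv.Perm (Fin b) → ℂ)
    (hf : ∀ x y, f (y * x * y⁻¹) = f x) (x : Equiv.Perm (Fin b)) :
    ∑ μ : b.Partition, (specht μ).character x * ((Nat.card (Equiv.Perm (Fin b)) : ℂ)⁻¹ *
      ∑ g, f g * (specht μ).character g) = f x := by
  classical
  let c : Equiv.Perm (Fin b) → (Fintype.card (Fin b)).Partition := Equiv.Perm.partition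
  have hfac : ∀ h : Equiv.Perm (Fin b) → ℂ, (∀ x y, h (y * x * y⁻¹) = h x) →
      ∀ x, Function.extend c h 0 (c x) = h x := by
    intro h hh x
    refine Function.FactorsThrough.extend_apply (fun y z hyz => ?_) _ _
    obtain ⟨p, hp⟩ := isConj_iff.1 (Equiv.Perm.partition_eq_of_isConj.2 hyz)
    rw [← hp, hh]
  have hchar : ∀ μ : b.Partition, ∀ x y,
      (specht μ).character (y * x * y⁻¹) = (specht μ).character x := fun μ x y =>
    char_conj _ _ _
  let X : Matrix b.Partition (Fintype.card (Fin b)).Partition ℂ :=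
    Matrix.of fun μ => Function.extend c (specht μ).character 0
  let d : (Fintype.card (Fin b)).Partition → ℂ := fun κ =>
    (Nat.card (Equiv.Perm (Fin b)) : ℂ)⁻¹ * (Finset.univ.filter fun g => c g = κ).card
  have hsum : ∀ F : (Fintype.card (Fin b)).Partition → ℂ,
      (Nat.card (Equiv.Perm (Fin b)) : ℂ)⁻¹ * ∑ g, F (c g) = ∑ κ, d κ * F κ := by
    intro F
    rw [← Finset.sum_fiberwise Finset.univ c, Finset.mul_sum]
    refine Finset.sum_congr rfl fun κ _ => ?_
    rw [Finset.sum_congr rfl fun g hg => by rw [(Finset.mem_filter.1 hg).2], Finset.sum_const,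
      nsmul_eq_mul, mul_assoc]
  have hXc : ∀ μ g, X μ (c g) = (specht μ).character g := fun μ g => hfac _ (hchar μ) g
  have hX : X * (Matrix.diagonal d * X.transpose) = 1 := by
    ext μ ν
    rw [Matrix.mul_apply, Matrix.one_apply, ← sum_char_specht_mul_char_specht]
    symm
    rw [Finset.sum_congr rfl fun g _ => by rw [← hXc μ g, ← hXc ν g],
      hsum fun κ => X μ κ * X ν κ]
    refine Finset.sum_congr rfl fun κ _ => ?_
    rw [Matrix.diagonal_mul, Matrix.transpose_apply]
    ring
  have hX' : (Matrix.diagonal d * X.transpose) * X = 1 :=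
    (Matrix.mul_eq_one_comm_of_equiv (Fintype.equivOfCardEq card_partition_fin)).1 hX
  have hX'' := congrArg Matrix.transpose hX'
  rw [Matrix.transpose_mul, Matrix.transpose_mul, Matrix.transpose_transpose,
    Matrix.diagonal_transpose, Matrix.transpose_one] at hX''
  have h := congrFun (congrArg (fun A => A.mulVec (Function.extend c f 0)) hX'') (c x)
  rw [Matrix.one_mulVec, hfac f hf, ← Matrix.mulVec_mulVec, ← Matrix.mulVec_mulVec] at h
  rw [← h]
  refine Finset.sum_congr rfl fun μ _ => ?_
  change _ = X μ (c x) * X.mulVec _ μ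
  rw [hXc μ x]
  congr 1
  rw [Finset.sum_congr rfl fun g _ => by rw [← hXc μ g, ← hfac f hf g],
    hsum fun κ => Function.extend c f 0 κ * X μ κ]
  refine Finset.sum_congr rfl fun κ _ => ?_
  rw [Matrix.mulVec_diagonal]
  ring

/-- Column orthogonality of the characters of the Specht modules. -/
theorem sum_char_specht_mul_char_specht_apply (g x : Equiv.Perm (Fin b)) :
    ∑ μ : b.Partition, (specht μ).character x * (specht μ).character g =
      Nat.card {p : Equiv.Perm (Fin b) // g * p = p * x} := by
  have h := sum_char_specht_mul_sum
    (fun x => (Nat.card {p : Equiv.Perm (Fin b) // g * p = p * x} : ℂ)) (fun x y => by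
      congr 1
      refine Nat.card_congr ((Equiv.mulRight y).subtypeEquiv fun p => ?_)
      rw [Equiv.coe_mulRight, ← mul_left_inj y]
      simp [mul_assoc]) x
  rw [← h]
  refine Finset.sum_congr rfl fun μ _ => ?_
  congr 1
  have : ∀ y, (Nat.card {p : Equiv.Perm (Fin b) // g * p = p * y} : ℂ) * (specht μ).character y =
      ∑ p, if y = p⁻¹ * g * p then (specht μ).character y else 0 := by
    intro y
    rw [Nat.card_eq_fintype_card, Fintype.card_subtype, Finset.card_filter, Nat.cast_sum,
      Finset.sum_mul]
    refine Finset.sum_congr rfl fun p _ => ?_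
    have h1 : g * p = p * y ↔ y = p⁻¹ * g * p := by
      rw [mul_assoc, eq_inv_mul_iff_mul_eq, eq_comm]
    simp only [h1]
    split_ifs <;> simp
  rw [Finset.sum_congr rfl fun y _ => this y, Finset.sum_comm]
  have h2 : ∀ p : Equiv.Perm (Fin b), (specht μ).character (p⁻¹ * g * p) =
      (specht μ).character g := fun p => by
    have := char_conj (specht μ) g p⁻¹
    rwa [inv_inv] at this
  simp only [Finset.sum_ite_eq', Finset.mem_univ, if_true, h2, Finset.sum_const, Finset.card_univ]
  rw [nsmul_eq_mul, ← Nat.card_eq_fintype_card, inv_mul_cancel_left₀ (NeZero.ne _)]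

theorem kronecker_eq (μ lam ν : b.Partition) :
    (kronecker μ lam ν : ℂ) = (Nat.card (Equiv.Perm (Fin b)) : ℂ)⁻¹ *
      ∑ g, (specht ν).character g * ((specht μ).character g * (specht lam).character g) := by
  unfold kronecker multiplicity
  have h := sum_char_mul_char (W := SpechtV μ ⊗[ℂ] SpechtV lam) (specht ν)
    ((specht μ).tprod (specht lam))
  rw [char_tensor] at h
  exact h.symm

/-- The product of the characters of two Specht modules. -/
theorem sum_kronecker_mul_char (μ ν : b.Partition) (g : Equiv.Perm (Fin b)) :
    ∑ lam, (kronecker μ lam ν : ℂ) * (specht lam).character g =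
      (specht μ).character g * (specht ν).character g := by
  rw [← sum_char_specht_mul_sum (fun g => (specht μ).character g * (specht ν).character g)
    (fun x y => by rw [char_conj, char_conj]) g]
  refine Finset.sum_congr rfl fun lam _ => ?_
  rw [kronecker_eq, mul_comm]
  congr 2
  exact Finset.sum_congr rfl fun x _ => by ring

theorem sum_kronecker_mul_char_mul_char (ν : b.Partition) (g x : Equiv.Perm (Fin b)) :
    ∑ p : b.Partition × b.Partition,
      (kronecker p.1 p.2 ν : ℂ) * ((specht p.1).character x * (specht p.2).character g) =
      Nat.card {p : Equiv.Perm (Fin b) // g * p = p * x} * (specht ν).character g := by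
  rw [← sum_char_specht_mul_char_specht_apply, Fintype.sum_prod_type, Finset.sum_mul]
  refine Finset.sum_congr rfl fun μ _ => ?_
  rw [mul_assoc, ← sum_kronecker_mul_char, Finset.mul_sum]
  exact Finset.sum_congr rfl fun lam _ => by ring

instance fintypeWreath (a b : ℕ) : Fintype (Wreath a b) :=
  Fintype.ofEquiv _ SemidirectProduct.equivProd.symm

/-! ### The stabilizer of an ordered set partition in a Young subgroup -/

section Points

variable {a b : ℕ} (hb : b ≤ (a + 1) * b) (hab : (a + 1) * b - b = a * b)

/-- The identification of the points on which the two factors of a Young subgroup act. -/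
def youngPoint {k n : ℕ} (hk : k ≤ n) : Fin k ⊕ Fin (n - k) ≃ Fin n :=
  finSumFinEquiv.trans (finCongr (Nat.add_sub_cancel' hk))

theorem youngHom_youngPoint {k n : ℕ} (hk : k ≤ n)
    (h : Equiv.Perm (Fin k) × Equiv.Perm (Fin (n - k))) (y : Fin k ⊕ Fin (n - k)) :
    youngHom hk h (youngPoint hk y) = youngPoint hk (Equiv.sumCongr h.1 h.2 y) := by
  simp [youngPoint, youngHom, Equiv.permCongrHom, Equiv.Perm.sumCongrHom, Equiv.permCongr_apply]

theorem youngHom_injective {k n : ℕ} (hk : k ≤ n) : Function.Injective (youngHom hk) :=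
  (Equiv.permCongrHom (youngPoint hk)).injective.comp Equiv.Perm.sumCongrHom_injective

theorem youngPoint_inl (i : Fin b) : youngPoint hb (Sum.inl i) =
    finProdFinEquiv ((0 : Fin (a + 1)), i) := by
  ext
  simp [youngPoint]

theorem youngPoint_inr (x : Fin a) (i : Fin b) :
    youngPoint hb (Sum.inr (finCongr hab.symm (finProdFinEquiv (x, i)))) =
      finProdFinEquiv (x.succ, i) := by
  ext
  simp [youngPoint]
  ring

theorem wreathHom_apply {a b : ℕ} (w : Wreath a b) (x : Fin a) (i : Fin b) :
    wreathHom a b w (finProdFinEquiv (x, i)) =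
      finProdFinEquiv (w.left (w.right i) x, w.right i) := by
  simp [wreathHom, wreathProdHom, Equiv.permCongrHom, Equiv.permCongr_apply]

theorem lt_iff_eq_zero (x : Fin (a + 1)) (i : Fin b) :
    (finProdFinEquiv (x, i)).val < b ↔ x = 0 := by
  rw [finProdFinEquiv_apply_val]
  dsimp only
  constructor
  · intro h
    by_contra hx
    have h1 : 1 ≤ x.val := Nat.one_le_iff_ne_zero.2 fun h0 => hx (Fin.ext h0)
    have := Nat.mul_le_mul_left b h1
    omega
  · rintro rfl
    simp

/-- The embedding of wreath products induced by the embedding of `S_a` in `S_{a+1}` as the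
stabilizer of `0`. -/
def wreathSucc (w : Wreath a b) : Wreath (a + 1) b :=
  ⟨fun i => Equiv.Perm.decomposeFin.symm (0, w.left i), w.right⟩

theorem wreathSucc_injective : Function.Injective (wreathSucc (a := a) (b := b)) := by
  intro v w h
  refine SemidirectProduct.ext ?_ (congrArg (fun u : Wreath (a + 1) b => u.right) h)
  funext i
  have := congrFun (congrArg (fun u : Wreath (a + 1) b => u.left) h) i
  exact congrArg Prod.snd (Equiv.Perm.decomposeFin.symm.injective this)

/-- The homomorphism from `S_a ≀ S_b` to `S_b × S_{ab}` whose image is the stabilizer of the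
standard set partition. -/
def wreathYoungHom : Wreath a b →* Equiv.Perm (Fin b) × Equiv.Perm (Fin ((a + 1) * b - b)) :=
  SemidirectProduct.rightHom.prod
    ((Equiv.permCongrHom (finCongr hab.symm)).toMonoidHom.comp (wreathHom a b))

theorem youngHom_wreathYoungHom (w : Wreath a b) :
    youngHom hb (wreathYoungHom hab w) = wreathHom (a + 1) b (wreathSucc w) := by
  ext1 p
  obtain ⟨⟨x, i⟩, rfl⟩ := finProdFinEquiv.surjective p
  rw [wreathHom_apply]
  refine Fin.cases ?_ (fun x => ?_) x
  · rw [← youngPoint_inl hb, youngHom_youngPoint]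
    simp only [Equiv.sumCongr_apply, Sum.map_inl, youngPoint_inl, wreathSucc,
      Equiv.Perm.decomposeFin_symm_apply_zero]
    rfl
  · rw [← youngPoint_inr hb hab, youngHom_youngPoint]
    simp only [Equiv.sumCongr_apply, Sum.map_inr, wreathSucc,
      Equiv.Perm.decomposeFin_symm_apply_succ, Equiv.swap_self, Equiv.refl_apply]
    rw [← youngPoint_inr hb hab, ← wreathHom_apply]
    simp [wreathYoungHom, Equiv.permCongrHom, Equiv.permCongr_apply]

theorem exists_wreathSucc_eq (u : Wreath (a + 1) b)
    (x : Equiv.Perm (Fin b) × Equiv.Perm (Fin ((a + 1) * b - b)))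
    (h : wreathHom (a + 1) b u = youngHom hb x) : ∃ w, wreathSucc w = u := by
  have h0 : ∀ j, u.left j 0 = 0 := by
    intro j
    rw [← lt_iff_eq_zero _ j]
    have h1 := wreathHom_apply u 0 (u.right⁻¹ j)
    rw [perm_apply_inv] at h1
    rw [← h1, h, youngHom_lt_iff, lt_iff_eq_zero]
  refine ⟨⟨fun i => (Equiv.Perm.decomposeFin (u.left i)).2, u.right⟩, SemidirectProduct.ext ?_ rfl⟩
  funext i
  change Equiv.Perm.decomposeFin.symm (0, (Equiv.Perm.decomposeFin (u.left i)).2) = u.left i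
  rw [Equiv.symm_apply_eq]
  refine Prod.ext ?_ rfl
  have := Equiv.Perm.decomposeFin_symm_apply_zero (Equiv.Perm.decomposeFin (u.left i)).1
    (Equiv.Perm.decomposeFin (u.left i)).2
  rw [Prod.mk.eta, Equiv.symm_apply_apply, h0] at this
  exact this

/-- The standard set partition has type `(1^b)`. -/
theorem blockType_one : blockType b (1 : Equiv.Perm (Fin ((a + 1) * b))) =
    (onesPartition b).parts := by
  have h1 : ∀ i : Fin b, ((block (1 : Equiv.Perm (Fin ((a + 1) * b))) i).filter
      fun x => x.val < b).card = 1 := by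
    intro i
    rw [Finset.card_eq_one]
    refine ⟨finProdFinEquiv ((0 : Fin (a + 1)), i), ?_⟩
    ext p
    simp only [block, Finset.mem_filter, Finset.mem_image, Finset.mem_univ, true_and,
      Finset.mem_singleton, Equiv.Perm.one_apply]
    constructor
    · rintro ⟨⟨x, rfl⟩, hx⟩
      rw [(lt_iff_eq_zero x i).1 hx]
    · rintro rfl
      exact ⟨⟨0, rfl⟩, (lt_iff_eq_zero 0 i).2 rfl⟩
  unfold blockType
  simp only [h1]
  rw [Multiset.filter_eq_self.2]
  · simp [onesPartition]
  · intro n hn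
    obtain ⟨-, -, rfl⟩ := Multiset.mem_map.1 hn
    exact one_ne_zero

theorem exists_lt_of_blockType_eq {g : Equiv.Perm (Fin ((a + 1) * b))}
    (hg : blockType b g = (onesPartition b).parts) (i : Fin b) :
    ∃ x : Fin (a + 1), (g (finProdFinEquiv (x, i))).val < b := by
  unfold blockType at hg
  set m := (Finset.univ : Finset (Fin b)).val.map
    fun i => ((block g i).filter fun x => x.val < b).card with hm
  have hle : m.filter (· ≠ 0) = m := by
    refine Multiset.eq_of_le_of_card_le (Multiset.filter_le _ _) ?_
    rw [hg, hm]
    simp [onesPartition]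
  have hi : ((block g i).filter fun x => x.val < b).card ∈ m :=
    Multiset.mem_map_of_mem _ (Finset.mem_univ i)
  rw [← hle, hg] at hi
  have hc := Multiset.eq_of_mem_replicate hi
  obtain ⟨p, hp⟩ := Finset.card_pos.1 (hc ▸ Nat.one_pos)
  simp only [block, Finset.mem_filter, Finset.mem_image, Finset.mem_univ, true_and] at hp
  obtain ⟨⟨x, rfl⟩, hx⟩ := hp
  exact ⟨x, hx⟩

theorem mem_range_youngHom {k n : ℕ} (hk : k ≤ n) (g : Equiv.Perm (Fin n))
    (h : ∀ p : Fin n, p.val < k → (g p).val < k) : ∃ x, youngHom hk x = g := by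
  have hlt : ∀ y, (youngPoint hk y).val < k ↔ y ∈ Set.range Sum.inl := by
    rintro (y | y) <;> simp [youngPoint]
  have := Equiv.Perm.mem_sumCongrHom_range_of_perm_mapsTo_inl
    (σ := (Equiv.permCongrHom (youngPoint hk)).symm g) (fun y hy => by
      rw [← hlt] at hy ⊢
      simpa [Equiv.permCongrHom, Equiv.permCongr_apply] using h _ hy)
  obtain ⟨x, hx⟩ := this
  refine ⟨x, ?_⟩
  change Equiv.permCongrHom (youngPoint hk) (Equiv.Perm.sumCongrHom _ _ x) = g
  rw [hx, MulEquiv.apply_symm_apply]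

/-- The Young subgroup acts transitively on the set partitions of type `(1^b)`. -/
theorem exists_youngHom_mul_wreathHom {g : Equiv.Perm (Fin ((a + 1) * b))}
    (hg : blockType b g = (onesPartition b).parts) :
    ∃ x u, youngHom hb x = g * wreathHom (a + 1) b u := by
  choose x hx using exists_lt_of_blockType_eq hg
  let u : Wreath (a + 1) b := ⟨fun i => Equiv.swap 0 (x i), 1⟩
  obtain ⟨y, hy⟩ := mem_range_youngHom hb (g * wreathHom (a + 1) b u) (fun p hp => by
    obtain ⟨⟨z, i⟩, rfl⟩ := finProdFinEquiv.surjective p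
    rw [lt_iff_eq_zero] at hp
    subst hp
    rw [Equiv.Perm.mul_apply, wreathHom_apply]
    simpa [u] using hx i)
  exact ⟨y, u, hy⟩

/-! ### The component as an induced representation -/

variable (ν : b.Partition)

/-- The map from the representation induced from the stabilizer of the standard set partition to
the generalized Foulkes module. -/
def stabIndMap : IndV (wreathYoungHom hab) (inflSpecht ν a) →ₗ[ℂ] FoulkesV ν (a + 1) :=
  indLift _ _ (fun x => IndV.mk (wreathHom (a + 1) b) (inflSpecht ν (a + 1)) (youngHom hb x))
    fun w g v => by
      rw [map_mul, youngHom_wreathYoungHom]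
      exact ind_mk_smul (wreathHom (a + 1) b) (inflSpecht ν (a + 1)) (wreathSucc w) _ v

theorem stabIndMap_mk (x : Equiv.Perm (Fin b) × Equiv.Perm (Fin ((a + 1) * b - b)))
    (v : SpechtV ν) :
    stabIndMap hb hab ν (IndV.mk (wreathYoungHom hab) (inflSpecht ν a) x v) =
      IndV.mk (wreathHom (a + 1) b) (inflSpecht ν (a + 1)) (youngHom hb x) v :=
  indLift_mk _ _ _ _ _ _

theorem stabIndMap_comp_ind (x : Equiv.Perm (Fin b) × Equiv.Perm (Fin ((a + 1) * b - b))) :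
    stabIndMap hb hab ν ∘ₗ ind (wreathYoungHom hab) (inflSpecht ν a) x =
      foulkesRes ν (a + 1) hb x ∘ₗ stabIndMap hb hab ν := by
  refine IndV.hom_ext _ _ fun y => LinearMap.ext fun v => ?_
  change stabIndMap hb hab ν (ind (wreathYoungHom hab) (inflSpecht ν a) x (IndV.mk _ _ y v)) =
    foulkes ν (a + 1) (youngHom hb x) (stabIndMap hb hab ν (IndV.mk _ _ y v))
  rw [ind_mk, stabIndMap_mk, stabIndMap_mk, foulkes, ind_mk, map_mul, map_inv]

theorem indEval_stabIndMap (x : Equiv.Perm (Fin b) × Equiv.Perm (Fin ((a + 1) * b - b)))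
    (z : IndV (wreathYoungHom hab) (inflSpecht ν a)) :
    indEval (wreathHom (a + 1) b) (inflSpecht ν (a + 1)) (youngHom hb x)
      (stabIndMap hb hab ν z) = indEval (wreathYoungHom hab) (inflSpecht ν a) x z := by
  classical
  have : indEval (wreathHom (a + 1) b) (inflSpecht ν (a + 1)) (youngHom hb x) ∘ₗ
      stabIndMap hb hab ν = indEval (wreathYoungHom hab) (inflSpecht ν a) x := by
    refine IndV.hom_ext _ _ fun y => LinearMap.ext fun v => ?_
    change indEval (wreathHom (a + 1) b) (inflSpecht ν (a + 1)) (youngHom hb x)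
      (stabIndMap hb hab ν (IndV.mk _ _ y v)) =
        indEval (wreathYoungHom hab) (inflSpecht ν a) x (IndV.mk _ _ y v)
    rw [stabIndMap_mk, indEval_mk, indEval_mk]
    symm
    refine Fintype.sum_of_injective wreathSucc wreathSucc_injective _ _ ?_ ?_
    · intro u hu
      rw [if_neg]
      intro h
      rw [← eq_mul_inv_iff_mul_eq, ← map_inv, ← map_mul] at h
      exact hu (exists_wreathSucc_eq hb u _ h)
    · intro w
      rw [← youngHom_wreathYoungHom hb hab, ← map_mul, (youngHom_injective hb).eq_iff]
      rfl
  exact LinearMap.congr_fun this z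

theorem stabIndMap_injective : Function.Injective (stabIndMap hb hab ν) := by
  rw [← LinearMap.ker_eq_bot, LinearMap.ker_eq_bot']
  intro z hz
  refine eq_zero_of_indEval_eq_zero _ _ z fun x => ?_
  rw [← indEval_stabIndMap hb, hz, map_zero]

theorem range_stabIndMap : LinearMap.range (stabIndMap hb hab ν) =
    (component ν (a + 1) hb (onesPartition b)).toSubmodule := by
  apply le_antisymm
  · have hmk : ∀ x v, IndV.mk (wreathHom (a + 1) b) (inflSpecht ν (a + 1)) (youngHom hb x) v ∈
        (component ν (a + 1) hb (onesPartition b)).toSubmodule := by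
      intro x v
      have hv : v ∈ Submodule.span ℂ (Set.range (spechtPoly (ν := ν))) := by
        rw [span_spechtPoly]; trivial
      induction hv using Submodule.span_induction with
      | mem v hv =>
        obtain ⟨t, rfl⟩ := hv
        refine Submodule.subset_span ⟨youngHom hb x⁻¹ * 1, t, ?_, ?_⟩
        · rw [blockType_youngHom_mul, blockType_one]
        · rw [foulkesPoly, mul_one, map_inv, inv_inv]
      | zero => rw [map_zero]; exact zero_mem _
      | add v w _ _ hv hw => rw [map_add]; exact add_mem hv hw
      | smul c v _ hv => rw [map_smul]; exact Submodule.smul_mem _ c hv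
    have hle : (component ν (a + 1) hb (onesPartition b)).toSubmodule.mkQ ∘ₗ
        stabIndMap hb hab ν = 0 := by
      refine IndV.hom_ext _ _ fun x => LinearMap.ext fun v => ?_
      change Submodule.mkQ _ (stabIndMap hb hab ν (IndV.mk _ _ x v)) = 0
      rw [stabIndMap_mk, Submodule.mkQ_apply, Submodule.Quotient.mk_eq_zero]
      exact hmk x v
    rintro _ ⟨z, rfl⟩
    have := LinearMap.congr_fun hle z
    rwa [LinearMap.comp_apply, LinearMap.zero_apply, Submodule.mkQ_apply,
      Submodule.Quotient.mk_eq_zero] at this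
  · refine Submodule.span_le.2 ?_
    rintro _ ⟨g, t, hg, rfl⟩
    obtain ⟨x, u, hx⟩ := exists_youngHom_mul_wreathHom hb hg
    refine ⟨IndV.mk _ _ x⁻¹ (specht ν u.right⁻¹ (spechtPoly t)), ?_⟩
    rw [stabIndMap_mk, map_inv, hx, mul_inv_rev, ← map_inv]
    exact ind_mk_smul (wreathHom (a + 1) b) (inflSpecht ν (a + 1)) u⁻¹ g⁻¹ (spechtPoly t)

/-- `U_{ν,a+1}` is induced from the stabilizer of the standard set partition. -/
def stabIndEquiv :
    (ind (wreathYoungHom hab) (inflSpecht ν a)).Equiv (U ν (a + 1) hb) :=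
  Representation.Equiv.mk ((LinearEquiv.ofInjective _ (stabIndMap_injective hb hab ν)).trans
    (LinearEquiv.ofEq _ _ (range_stabIndMap hb hab ν))) fun x =>
      LinearMap.ext fun z => Subtype.ext (LinearMap.congr_fun (stabIndMap_comp_ind hb hab ν x) z)

end Points

/-! ### Characters of the representations in the decomposition -/

theorem character_outer {G H V W : Type*} [Group G] [Group H] [AddCommGroup V] [Module ℂ V]
    [FiniteDimensional ℂ V] [AddCommGroup W] [Module ℂ W] [FiniteDimensional ℂ W]
    (σ : Representation ℂ G V) (τ : Representation ℂ H W) (x : G × H) :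
    (outer σ τ).character x = σ.character x.1 * τ.character x.2 :=
  LinearMap.trace_tensorProduct' _ _

theorem character_castPerm {m n : ℕ} (h : n = m) {V : Type*} [AddCommGroup V] [Module ℂ V]
    (τ : Representation ℂ (Equiv.Perm (Fin m)) V) (x : Equiv.Perm (Fin n)) :
    (castPerm h τ).character x = τ.character (Equiv.permCongrHom (finCongr h) x) :=
  rfl

theorem natCard_subtype_mul_eq {G H : Type*} [Group G] [Group H] (e : G ≃* H) (w x : G) :
    Nat.card {g : G // w * g = g * x} = Nat.card {g : H // e w * g = g * e x} :=
  Nat.card_congr (e.toEquiv.subtypeEquiv fun g => by simp [← map_mul])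

theorem character_foulkes {b : ℕ} (lam : b.Partition) (a : ℕ) (x : Equiv.Perm (Fin (a * b))) :
    (foulkes lam a).character x = (Nat.card (Wreath a b) : ℂ)⁻¹ * ∑ w : Wreath a b,
      (Nat.card {g : Equiv.Perm (Fin (a * b)) // wreathHom a b w * g = g * x} : ℂ) *
        (specht lam).character w.right :=
  char_ind _ _ _

/-- `S_1 ≀ S_b` is `S_b`. -/
def wreathOneEquiv (b : ℕ) : Equiv.Perm (Fin b) ≃ Wreath 1 b where
  toFun σ := ⟨1, σ⟩
  invFun w := w.right
  left_inv _ := rfl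
  right_inv _ := SemidirectProduct.ext (Subsingleton.elim _ _) rfl

/-- The character of `F_λ^1 ≅ S^λ`. -/
theorem character_foulkes_one {b : ℕ} (lam : b.Partition) (x : Equiv.Perm (Fin (1 * b))) :
    (foulkes lam 1).character x =
      (specht lam).character (Equiv.permCongrHom (finCongr (one_mul b)) x) := by
  set y := Equiv.permCongrHom (finCongr (one_mul b)) x with hy
  rw [character_foulkes, ← Nat.card_congr (wreathOneEquiv b),
    ← (wreathOneEquiv b).sum_comp, ← sum_char_specht_mul_sum (specht lam).character
      (fun x y => char_conj _ _ _) y]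
  simp only [Finset.mul_sum]
  rw [Finset.sum_comm]
  refine Finset.sum_congr rfl fun σ _ => ?_
  have hσ : Equiv.permCongrHom (finCongr (one_mul b)) (wreathHom 1 b (wreathOneEquiv b σ)) = σ := by
    ext i
    have : (finCongr (one_mul b)).symm i = finProdFinEquiv ((0 : Fin 1), i) := by
      ext; simp
    change (finCongr (one_mul b) (wreathHom 1 b (wreathOneEquiv b σ)
      ((finCongr (one_mul b)).symm i))).val = _
    rw [this, wreathHom_apply]
    simp [wreathOneEquiv]
  rw [natCard_subtype_mul_eq (Equiv.permCongrHom (finCongr (one_mul b))), hσ, ← hy,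
    ← sum_char_specht_mul_char_specht_apply, Finset.sum_mul, Finset.mul_sum]
  refine Finset.sum_congr rfl fun μ _ => ?_
  change _ * (_ * (specht lam).character σ) = _
  ring

theorem character_U {a b : ℕ} (hb : b ≤ (a + 1) * b) (hab : (a + 1) * b - b = a * b)
    (ν : b.Partition) (x : Equiv.Perm (Fin b) × Equiv.Perm (Fin ((a + 1) * b - b))) :
    (U ν (a + 1) hb).character x =
      ∑ p : b.Partition × b.Partition, (kronecker p.1 p.2 ν : ℂ) *
        ((specht p.1).character x.1 *
          (foulkes p.2 a).character (Equiv.permCongrHom (finCongr hab) x.2)) := by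
  rw [← char_iso (stabIndEquiv hb hab ν), char_ind]
  simp only [character_foulkes, Finset.mul_sum]
  rw [Finset.sum_comm]
  refine Finset.sum_congr rfl fun w _ => ?_
  have h1 : Nat.card {g // wreathYoungHom hab w * g = g * x} =
      Nat.card {p // w.right * p = p * x.1} *
        Nat.card {q // wreathHom a b w * q = q * Equiv.permCongrHom (finCongr hab) x.2} := by
    have h2 := natCard_subtype_mul_eq (Equiv.permCongrHom (finCongr hab))
      (Equiv.permCongrHom (finCongr hab.symm) (wreathHom a b w)) x.2
    have h3 : Equiv.permCongrHom (finCongr hab)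
        (Equiv.permCongrHom (finCongr hab.symm) (wreathHom a b w)) = wreathHom a b w := by
      ext i
      simp [Equiv.permCongrHom, Equiv.permCongr_apply]
    rw [h3] at h2
    rw [← h2, ← Nat.card_prod]
    exact Nat.card_congr ((Equiv.subtypeEquivRight fun g => by
      rw [Prod.ext_iff]; rfl).trans (Equiv.subtypeProdEquivProd
        (p := fun p => w.right * p = p * x.1)
        (q := fun q => Equiv.permCongrHom (finCongr hab.symm) (wreathHom a b w) * q = q * x.2)))
  have h4 := sum_kronecker_mul_char_mul_char ν w.right x.1
  change _ * (_ * (specht ν).character w.right) = _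
  rw [h1, Nat.cast_mul, mul_right_comm, ← h4, Finset.sum_mul, Finset.mul_sum]
  exact Finset.sum_congr rfl fun p _ => by ring

theorem nonempty_equiv_directSum {G V₀ ι : Type*} [Group G] [Finite G] [AddCommGroup V₀]
    [Module ℂ V₀] [FiniteDimensional ℂ V₀] [Fintype ι] {V : ι → Type*} [∀ i, AddCommGroup (V i)]
    [∀ i, Module ℂ (V i)] [∀ i, FiniteDimensional ℂ (V i)] (ρ : Representation ℂ G V₀)
    (σ : ∀ i, Representation ℂ G (V i))
    (h : ∀ x, ρ.character x = ∑ i, (σ i).character x) : Nonempty (ρ.Equiv (directSum σ)) := by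
  classical
  have : FiniteDimensional ℂ (DirectSum ι V) := inferInstanceAs (FiniteDimensional ℂ (Π₀ i, V i))
  refine nonempty_equiv_of_character_eq ρ (directSum σ) (funext fun x => ?_)
  rw [h, char_directSum]

theorem nonempty_U_equiv {a b : ℕ} (hb : b ≤ (a + 1) * b) (hab : (a + 1) * b - b = a * b)
    (ν : b.Partition) {W : b.Partition → Type*} [∀ lam, AddCommGroup (W lam)]
    [∀ lam, Module ℂ (W lam)] [∀ lam, FiniteDimensional ℂ (W lam)]
    (τ : ∀ lam, Representation ℂ (Equiv.Perm (Fin ((a + 1) * b - b))) (W lam))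
    (hτ : ∀ lam x, (τ lam).character x =
      (foulkes lam a).character (Equiv.permCongrHom (finCongr hab) x)) :
    Nonempty ((U ν (a + 1) hb).Equiv (Representation.directSum
        (fun i : (p : b.Partition × b.Partition) × Fin (kronecker p.1 p.2 ν) =>
          outer (specht i.1.1) (τ i.1.2)))) := by
  refine nonempty_equiv_directSum (V := fun i : (p : b.Partition × b.Partition) ×
    Fin (kronecker p.1 p.2 ν) => SpechtV i.1.1 ⊗[ℂ] W i.1.2) (U ν (a + 1) hb)
    (fun i => outer (specht i.1.1) (τ i.1.2)) fun x => ?_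
  rw [character_U hb hab]
  rw [Fintype.sum_sigma]
  refine Finset.sum_congr rfl fun p _ => ?_
  refine Eq.trans ?_ (Finset.sum_congr rfl fun y _ => ((character_outer (specht p.1)
    (τ p.2) x).trans (congrArg _ (hτ p.2 x.2))).symm)
  rw [Finset.sum_const, Finset.card_univ, Fintype.card_fin, nsmul_eq_mul]

end GenFoulkes

end

theorem theorem1 (a b : ℕ) (ha : 2 ≤ a) (hb : 2 ≤ b) (ν : b.Partition) :
    Nonempty ((GenFoulkes.U ν a (Nat.le_mul_of_pos_left b (by omega))).Equiv
      (Representation.directSum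
        (fun i : (p : b.Partition × b.Partition) × Fin (GenFoulkes.kronecker p.1 p.2 ν) =>
          GenFoulkes.outer (GenFoulkes.specht i.1.1)
            (GenFoulkes.castPerm (Nat.sub_one_mul a b).symm
              (GenFoulkes.foulkes i.1.2 (a - 1)))))) ∧
    Nonempty ((GenFoulkes.U ν 2 (Nat.le_mul_of_pos_left b (by omega))).Equiv
      (Representation.directSum
        (fun i : (p : b.Partition × b.Partition) × Fin (GenFoulkes.kronecker p.1 p.2 ν) =>
          GenFoulkes.outer (GenFoulkes.specht i.1.1)
            (GenFoulkes.castPerm (show 2 * b - b = b by omega)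
              (GenFoulkes.specht i.1.2))))) := by
  constructor
  · obtain ⟨a, rfl⟩ : ∃ a', a = a' + 1 := ⟨a - 1, by omega⟩
    exact GenFoulkes.nonempty_U_equiv _ (Nat.sub_one_mul (a + 1) b).symm ν
      (fun lam => GenFoulkes.castPerm (Nat.sub_one_mul (a + 1) b).symm (GenFoulkes.foulkes lam a))
      fun lam x => rfl
  · refine GenFoulkes.nonempty_U_equiv (a := 1) _ (Nat.sub_one_mul 2 b).symm ν
      (fun lam => GenFoulkes.castPerm (show 2 * b - b = b by omega) (GenFoulkes.specht lam))
      fun lam x => ?_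
    rw [GenFoulkes.character_foulkes_one, GenFoulkes.character_castPerm]
    rfl
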